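/- **Setting.** Let $s\in L^2([0,1])$ be a probability density on $[0,1]$. Let $\psi_0=1$, $\psi_j(t)=\sqrt2\cos(2\pi jt)$ for $j\ge1$, and $\theta_j=\langle s,\psi_j\rangle$. Let $X_1,\dots,X_n$ be i.i.d. with density $s$, let $T\subset\{1,\dots,n\}$ have cardinality $n_t\geq 1$, and for $k\in\mathbb N$ let $$\hat s_k^T=\sum_{j=0}^k\Big(\frac1{n_t}\sum_{i\in T}\psi_j(X_i)\Big)\psi_j .$$ Write $\|\cdot\|$ for the norm of $L^2([0,1])$ and put $k_*=\max\{k\in\mathbb N:\theta_k^2\ge 1/n_t\}$, $$\Delta_d=\max\Big\{l\in\mathbb N:\theta_{k_*+l}^2\ge\Big[1-\sqrt{\tfrac{n_t}{n-n_t}}\tfrac1{\sqrt l}\Big]\tfrac1{n_t}\Big\},\qquad \Delta_g=\min\Big\{l\in\{0,\dots,k_*\}:\theta_{k_*-l}^2\ge\Big[1+\sqrt{\tfrac{n_t}{n-n_t}}\tfrac1{\sqrt l}\Big]\tfrac1{n_t}\Big\}$$ (with $1/\sqrt0=+\infty$ and $\min\emptyset=0$), $\Delta=\max(\Delta_d,\Delta_g)$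 and $\mathfrak e=\sqrt{\Delta/(n_t(n-n_t))}$. Let $R(k)=\sum_{j\ge k+1}\theta_j^2$ for $k\in\mathbb N$, extended to $\mathbb R_+$ by linear interpolation between consecutive integers. For $\alpha\ge -k_*/\Delta$ let $$f_n(\alpha)=\frac1{\mathfrak e}\Big(R(k_*+\alpha\Delta)-R(k_*)+\frac{\alpha\Delta}{n_t}\Big),$$ and let the rescaled excess risk $L$ be defined for integers $j\ge -k_*$ by $$L\big(\tfrac j\Delta\big)=\frac1{\mathfrak e}\Big(\|\hat s^T_{k_*+j}-s\|^2-\|\hat s^T_{k_*}-s\|^2\Big),$$ extended by linear interpolation to $[-k_*/\Delta,+\infty)$. For $x>0$ let $a_x=\min\{\frac j\Delta:j\in\{-k_*,\dots,0\},\,f_n(\frac j\Delta)\le x\}$ and $b_x=\max\{\frac j\Delta:j\in\mathbb N,\,f_n(\frac j\Delta)\le x\}$. (In the degenerate case $\Delta=0$, possible only if $n_t<n-n_t$, the quotients by $\Delta$ and $\mathfrak e$ are read as $0$, and the statement is trivial.) **Claim.** Let $c_1,\delta_1\ge0$ and $\delta_4,\delta_5>0$. There is a constant $\kappa_1\ge0$,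 depending only on $c_1,\delta_1,\delta_4,\delta_5$, such that the following holds for every $s$ such that $(\theta_j^2)_{j\in\mathbb N}$ is non-increasing and $\sum_{j\ge k+1}\theta_j^2\le c_1k^{-(2+\delta_1)}$ for all $k\ge1$, and for all $n$ and $n_t\ge1$ with $n^{2/3+\delta_5}\le n-n_t\le n^{1-\delta_4}$. The function $f_n$ is convex on $[-k_*/\Delta,+\infty)$, and for every $T$ with $|T|=n_t$ and all $x>0$, $y>0$, with probability at least $1-e^{-y}$, $$\sup_{\alpha\in[a_x,b_x]}|L(\alpha)-f_n(\alpha)|\le\kappa_1(1+x)\,[\log(2+x)+y+\log n]^2\,n^{-\min(\frac1{12},\frac{\delta_4}2)} .$$ -/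

import Mathlib

open MeasureTheory ProbabilityTheory

noncomputable section

namespace CosDensity

/-- Lebesgue measure on the unit interval. -/
def lebesgue01 : Measure ℝ := volume.restrict (Set.Icc 0 1)

/-- `s` is a probability density on `[0,1]` that belongs to `L²([0,1])`. -/
structure IsL2Density (s : ℝ → ℝ) : Prop where
  memLp : MemLp s 2 lebesgue01
  nonneg : ∀ᵐ t ∂lebesgue01, 0 ≤ s t
  integral_eq_one : ∫ t, s t ∂lebesgue01 = 1

/-- The probability distribution `s(t) dt` on `[0,1]`. -/
def law (s : ℝ → ℝ) : Measure ℝ := lebesgue01.withDensity fun t => ENNReal.ofReal (s t)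

/-- The cosine basis: `ψ₀ = 1` and `ψ_j(t) = √2 cos(2πjt)` for `j ≥ 1`. -/
def psi (j : ℕ) (t : ℝ) : ℝ :=
  if j = 0 then 1 else √2 * Real.cos (2 * Real.pi * j * t)

/-- The Fourier coefficient `θ_j = ⟨s, ψ_j⟩`. -/
def theta (s : ℝ → ℝ) (j : ℕ) : ℝ := ∫ t, s t * psi j t ∂lebesgue01

/-- The tail sum `R(k) = ∑_{j ≥ k+1} θ_j²`. -/
def tailSum (s : ℝ → ℝ) (k : ℕ) : ℝ := ∑' i : ℕ, theta s (k + 1 + i) ^ 2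

/-- The extension of a sequence `u` to `ℝ₊` by linear interpolation between the integers. -/
def linInterp (u : ℕ → ℝ) (x : ℝ) : ℝ :=
  (1 + ⌊x⌋₊ - x) * u ⌊x⌋₊ + (x - ⌊x⌋₊) * u (⌊x⌋₊ + 1)

/-- The empirical mean `P_n^T(f) = |T|⁻¹ ∑_{i ∈ T} f(x_i)`. -/
def empMean {n : ℕ} (x : Fin n → ℝ) (T : Finset (Fin n)) (f : ℝ → ℝ) : ℝ :=
  (∑ i ∈ T, f (x i)) / T.card

/-- The empirical orthogonal series estimator `ŝ_k^T = ∑_{j=0}^k P_n^T(ψ_j) ψ_j`. -/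
def estimator {n : ℕ} (x : Fin n → ℝ) (T : Finset (Fin n)) (k : ℕ) (t : ℝ) : ℝ :=
  ∑ j ∈ Finset.range (k + 1), empMean x T (psi j) * psi j t

/-- The quadratic risk `‖ŝ_k^T - s‖²` in `L²([0,1])`. -/
def risk {n : ℕ} (s : ℝ → ℝ) (x : Fin n → ℝ) (T : Finset (Fin n)) (k : ℕ) : ℝ :=
  ∫ t, (estimator x T k t - s t) ^ 2 ∂lebesgue01

/-- `k_*(m) = max {k : θ_k² ≥ 1/m}`. -/
def kStar (s : ℝ → ℝ) (m : ℕ) : ℕ := sSup {k : ℕ | 1 / (m : ℝ) ≤ theta s k ^ 2}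

/-- `Δ_d = max {l : θ_{k_*+l}² ≥ [1 - √(n_t/(n-n_t)) / √l] / n_t}`, where `k_* = k_*(n_t)`.
The index `l = 0` always belongs to this set. -/
def deltaD (s : ℝ → ℝ) (nt n : ℕ) : ℕ :=
  sSup {l : ℕ | (1 - √((nt : ℝ) / ((n : ℝ) - nt)) * (1 / √(l : ℝ))) * (1 / (nt : ℝ))
    ≤ theta s (kStar s nt + l) ^ 2}

/-- `Δ_g = min {l ∈ {0,…,k_*} : θ_{k_*-l}² ≥ [1 + √(n_t/(n-n_t)) / √l] / n_t}`,
where `k_* = k_*(n_t)`. The index `l = 0`, for which the right-hand side is `+∞`, never satisfies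
the condition. The minimum of the empty set is read as `0`
(this is the only possibility when `k_* = 0`). -/
def deltaG (s : ℝ → ℝ) (nt n : ℕ) : ℕ :=
  sInf {l : ℕ | 1 ≤ l ∧ l ≤ kStar s nt ∧
    (1 + √((nt : ℝ) / ((n : ℝ) - nt)) * (1 / √(l : ℝ))) * (1 / (nt : ℝ))
      ≤ theta s (kStar s nt - l) ^ 2}

/-- `Δ = max(Δ_d, Δ_g)`. -/
def delta (s : ℝ → ℝ) (nt n : ℕ) : ℕ := max (deltaD s nt n) (deltaG s nt n)

/-- `𝓔 = Δ / n_t`. -/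
def bigE (s : ℝ → ℝ) (nt n : ℕ) : ℝ := (delta s nt n : ℝ) / nt

/-- `𝔢 = √(𝓔 / (n - n_t))`. -/
def smallE (s : ℝ → ℝ) (nt n : ℕ) : ℝ := √(bigE s nt n / ((n : ℝ) - nt))

/-- `f_n(α) = (R(k_* + αΔ) - R(k_*) + αΔ/n_t) / 𝔢` for `α ≥ -k_*/Δ`,
with `R` extended by linear interpolation. -/
def fn (s : ℝ → ℝ) (nt n : ℕ) (α : ℝ) : ℝ :=
  1 / smallE s nt n *
    (linInterp (tailSum s) ((kStar s nt : ℝ) + α * delta s nt n) - tailSum s (kStar s nt)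
      + α * delta s nt n / nt)

/-- The rescaled excess risk: `L(j/Δ) = (‖ŝ_{k_*+j}^T - s‖² - ‖ŝ_{k_*}^T - s‖²) / 𝔢` for integers
`j ≥ -k_*`, extended by linear interpolation to all `α ≥ -k_*/Δ`. Here `n_t = |T|`. -/
def excessRisk {n : ℕ} (s : ℝ → ℝ) (x : Fin n → ℝ) (T : Finset (Fin n)) (α : ℝ) : ℝ :=
  1 / smallE s T.card n *
    (linInterp (risk s x T) ((kStar s T.card : ℝ) + α * delta s T.card n)
      - risk s x T (kStar s T.card))

/-- `a_x = min {j/Δ : j ∈ {-k_*,…,0}, f_n(j/Δ) ≤ x}`. -/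
def lowerEnd (s : ℝ → ℝ) (nt n : ℕ) (x : ℝ) : ℝ :=
  sInf {u : ℝ | ∃ j : ℤ, -(kStar s nt : ℤ) ≤ j ∧ j ≤ 0 ∧ u = (j : ℝ) / delta s nt n ∧
    fn s nt n u ≤ x}

/-- `b_x = max {j/Δ : j ∈ ℕ, f_n(j/Δ) ≤ x}`. -/
def upperEnd (s : ℝ → ℝ) (nt n : ℕ) (x : ℝ) : ℝ :=
  sSup {u : ℝ | ∃ j : ℕ, u = (j : ℝ) / delta s nt n ∧ fn s nt n u ≤ x}

end CosDensity

end

open CosDensity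

/-!
Since the `ψ_j` are orthonormal, passing from the model `k - 1` to the model `k` changes the risk by
`(P_n^T ψ_k - θ_k)² - θ_k²` and changes `R(k)` by `-θ_k²`. So at grid points `L - f_n` is, up to sign,
`1 / 𝔢` times a sum of `(P_n^T ψ_k - θ_k)² - 1 / n_t` over the models `k` between `k_*` and `k_* + j`, and linear
interpolation cannot increase its absolute value (`excessRisk_sub_fn`, `riskFluct_sub_of_le`,
`abs_linInterp_le`). Convexity of `f_n` holds because the increments of `R` are non-decreasing.

*Bias.* As `θ_k²` is non-increasing with tails `O(k⁻²)`, it is `O(k⁻³)`, so `∑ |θ_k|` is finite. The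
variance of `ψ_k(X)` is `1 + θ_{2k} / √2 - θ_k²`, hence replacing the expectations by `1 / n_t` costs
only `O(1 / n_t)` in total, whatever the number of models.

*Fluctuations.* For a window `I` of `K` models, `∑_{k ∈ I} (∑_{i ∈ T} w_k(X_i))²`, with
`w_k = ψ_k - θ_k`, is the sum of a diagonal part, to which Hoeffding's inequality applies, and of twice
the martingale with increments `⟨S_{<i}, w(X_i)⟩`, where `S_{<i}` is the vector of the sums over the
earlier indices. Each coordinate of `S_{<i}` is `O(√(n_t u))` by Hoeffding's inequality. The conditional
variance of the increment is `O(|S_{<i}|²)`, because the Gram matrix of the `ψ_k` in `L²(s(t) dt)` is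
bounded, by Schur's test and the summability of `|θ_k|` (`integral_sq_sum_psi_law_le`). An exponential
moment bound in the manner of Freedman (`lintegral_exp_sum_truncIncr_le`) then gives deviations
`O(u² (n_t √K + √n_t K))` with probability `1 - O(n_t K) e^{-u}`
(`measure_quadratic_deviation_le`).

*Windows.* The definitions of `Δ_d` and `Δ_g` make `f_n` grow with slope at least a constant outside
`[-1, 1]`, except on the left when `Δ_g` is a minimum over the empty set; as `θ_0 = 1`, this requires
`n_t ≤ 2` or `k_* = 0`, so that `k_*` is bounded. Hence `[a_x, b_x]`
contains only `K = O((1 + x) Δ)` models (`le_of_fn_le_right`, `le_of_fn_le_left`). Moreover `Δ = O(n_t)` (`delta_le`).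

Dividing by `n_t² 𝔢` yields `O((1 + x) u² √((n - n_t) / n_t))`. A union bound over the windows takes
`u = y + O(log (2 + x) + log n)`, and `(n - n_t) / n_t = O(n^{-δ₄})`.
-/

namespace CosDensity

/-! ### Concentration of quadratic forms of independent sums -/

section Chaos

variable {ι κ E : Type*}

theorem integrable_of_abs_le [MeasurableSpace E] {μ : Measure E} [IsProbabilityMeasure μ]
    {g : E → ℝ} (hg : Measurable g) {b : ℝ} (hb : ∀ x, |g x| ≤ b) :
    Integrable g μ :=
  Integrable.of_bound hg.aestronglyMeasurable b (Filter.Eventually.of_forall hb)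

theorem measure_sum_ge_le [Fintype ι] [MeasurableSpace E] {μ : Measure E} [IsProbabilityMeasure μ]
    {g : E → ℝ} (hg : Measurable g) {b : ℝ} (hb0 : 0 < b)
    (hb : ∀ x, |g x| ≤ b) (h0 : ∫ x, g x ∂μ = 0) (T : Finset ι) {m u : ℝ} (hm : T.card ≤ m)
    (hm0 : 0 < m) (hu : 0 < u) :
    (Measure.pi fun _ : ι => μ).real {ω | b * √(2 * m * u) ≤ ∑ i ∈ T, g (ω i)}
      ≤ Real.exp (-u) := by
  have hpos : 0 < b * √(2 * m * u) := by positivity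
  rcases T.eq_empty_or_nonempty with rfl | hT
  · have : {ω : ι → E | b * √(2 * m * u) ≤ ∑ i ∈ (∅ : Finset ι), g (ω i)} = ∅ := by
      ext ω; simpa using hpos
    rw [this]; simp [Real.exp_nonneg]
  have hind : iIndepFun (fun (i : ι) (ω : ι → E) => g (ω i)) (Measure.pi fun _ : ι => μ) :=
    iIndepFun_pi fun _ => hg.aemeasurable
  have hsub : ∀ i ∈ T, HasSubgaussianMGF (fun ω : ι → E => g (ω i)) ((‖b - (-b)‖₊ / 2) ^ 2)
      (Measure.pi fun _ : ι => μ) := by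
    intro i _
    refine hasSubgaussianMGF_of_mem_Icc_of_integral_eq_zero
      (hg.comp (measurable_pi_apply i)).aemeasurable
      (Filter.Eventually.of_forall fun ω => abs_le.1 (hb (ω i))) ?_
    rw [← h0]
    exact integral_comp_eval (μ := fun _ : ι => μ) hg.aestronglyMeasurable
  refine (HasSubgaussianMGF.measure_sum_ge_le_of_iIndepFun hind hsub hpos.le).trans (Real.exp_le_exp.2 ?_)
  have hc : (0 : ℝ) < T.card := by exact_mod_cast hT.card_pos
  have hnn : ((∑ i ∈ T, (‖b - (-b)‖₊ / 2) ^ 2 : NNReal) : ℝ) = T.card * b ^ 2 := by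
    simp only [Finset.sum_const, nsmul_eq_mul, NNReal.coe_mul, NNReal.coe_natCast, NNReal.coe_pow,
      NNReal.coe_div, coe_nnnorm, Real.norm_eq_abs, NNReal.coe_ofNat, sub_neg_eq_add]
    rw [abs_of_pos (by linarith)]; ring
  rw [hnn, mul_pow, Real.sq_sqrt (by positivity), neg_div, neg_le_neg_iff,
    le_div_iff₀ (by positivity)]
  nlinarith [mul_le_mul_of_nonneg_left hm (by positivity : 0 ≤ b ^ 2 * u)]

/-- Two-sided Hoeffding inequality for centred sums of at most `m` coordinates. -/
theorem measure_abs_sum_ge_le [Fintype ι] [MeasurableSpace E] {μ : Measure E} [IsProbabilityMeasure μ]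
    {g : E → ℝ} (hg : Measurable g) {b : ℝ} (hb0 : 0 < b)
    (hb : ∀ x, |g x| ≤ b) (h0 : ∫ x, g x ∂μ = 0) (T : Finset ι) {m u : ℝ} (hm : T.card ≤ m)
    (hm0 : 0 < m) (hu : 0 < u) :
    (Measure.pi fun _ : ι => μ).real {ω | b * √(2 * m * u) ≤ |∑ i ∈ T, g (ω i)|}
      ≤ 2 * Real.exp (-u) := by
  have h1 := measure_sum_ge_le (ι := ι) hg hb0 hb h0 T hm hm0 hu
  have h2 := measure_sum_ge_le (ι := ι) (μ := μ) hg.neg hb0 (by simpa using hb)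
    (by simp [integral_neg, h0]) T hm hm0 hu
  have hsub : {ω : ι → E | b * √(2 * m * u) ≤ |∑ i ∈ T, g (ω i)|} ⊆
      {ω | b * √(2 * m * u) ≤ ∑ i ∈ T, g (ω i)} ∪ {ω | b * √(2 * m * u) ≤ ∑ i ∈ T, (-g) (ω i)} := by
    intro ω hω
    simpa [Finset.sum_neg_distrib] using le_abs.1 hω
  have := (measureReal_mono hsub (measure_ne_top _ _)).trans (measureReal_union_le
    (μ := Measure.pi fun _ : ι => μ) _ _)
  linarith

/-- The sum of `g (ω j)` over the indices `j ∈ T` that precede `i`. -/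
noncomputable def prefixSum [LinearOrder ι]
    (g : E → ℝ) (T : Finset ι) (i : ι) (ω : ι → E) : ℝ :=
  ∑ j ∈ T with j < i, g (ω j)

open Classical in
/-- The increment `⟨S_{<i}, w(ω_i)⟩` of the off-diagonal part of `∑_{k ∈ I} (∑_{i ∈ T} w_k(ω_i))²`,
replaced by `0` as soon as a coordinate of the vector `S_{<i}` of preceding sums exceeds `B`. -/
noncomputable def truncIncr [LinearOrder ι]
    (w : κ → E → ℝ) (I : Finset κ) (B : ℝ) (T : Finset ι) (i : ι) (ω : ι → E) : ℝ :=
  if ∀ k ∈ I, |prefixSum (w k) T i ω| ≤ B then ∑ k ∈ I, prefixSum (w k) T i ω * w k (ω i) else 0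

theorem measurable_prefixSum [LinearOrder ι] [MeasurableSpace E]
    {g : E → ℝ} (hg : Measurable g) (T : Finset ι) (i : ι) :
    Measurable (prefixSum g T i) := by
  unfold prefixSum
  exact Finset.measurable_sum _ fun j _ => hg.comp (measurable_pi_apply j)

theorem measurable_truncIncr [LinearOrder ι] [MeasurableSpace E]
    {w : κ → E → ℝ} (hw : ∀ k, Measurable (w k)) (I : Finset κ) (B : ℝ)
    (T : Finset ι) (i : ι) : Measurable (truncIncr w I B T i) := by
  unfold truncIncr
  refine Measurable.ite ?_ ?_ measurable_const
  · have : {ω : ι → E | ∀ k ∈ I, |prefixSum (w k) T i ω| ≤ B}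
        = ⋂ k ∈ I, {ω | |prefixSum (w k) T i ω| ≤ B} := by ext; simp
    rw [this]
    exact Finset.measurableSet_biInter _ fun k _ =>
      measurableSet_le (measurable_prefixSum (hw k) T i).abs measurable_const
  · exact Finset.measurable_sum _ fun k _ =>
      (measurable_prefixSum (hw k) T i).mul ((hw k).comp (measurable_pi_apply i))

theorem prefixSum_insert_of_le [LinearOrder ι]
    {g : E → ℝ} {s : Finset ι} {a i : ι} (hi : i ≤ a) (ω : ι → E) :
    prefixSum g (insert a s) i ω = prefixSum g s i ω := by
  unfold prefixSum
  rw [Finset.filter_insert, if_neg (not_lt.2 hi)]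

theorem prefixSum_update [LinearOrder ι]
    {g : E → ℝ} {s : Finset ι} {a i : ι} (hi : i ≤ a) (ω : ι → E) (x : E) :
    prefixSum g s i (Function.update ω a x) = prefixSum g s i ω := by
  unfold prefixSum
  refine Finset.sum_congr rfl fun j hj => ?_
  rw [Function.update_of_ne]
  exact ((Finset.mem_filter.1 hj).2.trans_le hi).ne

theorem truncIncr_insert_of_le [LinearOrder ι]
    {w : κ → E → ℝ} {I : Finset κ} {B : ℝ} {s : Finset ι} {a i : ι}
    (hi : i ≤ a) (ω : ι → E) :
    truncIncr w I B (insert a s) i ω = truncIncr w I B s i ω := by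
  unfold truncIncr
  simp only [prefixSum_insert_of_le hi]

theorem truncIncr_update_of_lt [LinearOrder ι]
    {w : κ → E → ℝ} {I : Finset κ} {B : ℝ} {s : Finset ι} {a i : ι}
    (hi : i < a) (ω : ι → E) (x : E) :
    truncIncr w I B s i (Function.update ω a x) = truncIncr w I B s i ω := by
  unfold truncIncr
  simp only [prefixSum_update hi.le, Function.update_of_ne hi.ne]

theorem lintegral_exp_le [MeasurableSpace E] {μ : Measure E} [IsProbabilityMeasure μ]
    {Z : E → ℝ} (hZ : Measurable Z) (h1 : ∀ x, |Z x| ≤ 1)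
    (h0 : ∫ x, Z x ∂μ = 0) {v : ℝ} (hv : ∫ x, Z x ^ 2 ∂μ ≤ v) :
    ∫⁻ x, ENNReal.ofReal (Real.exp (Z x)) ∂μ ≤ ENNReal.ofReal (Real.exp v) := by
  have hiZ := integrable_of_abs_le (μ := μ) hZ h1
  have hiZ2 : Integrable (fun x => Z x ^ 2) μ :=
    integrable_of_abs_le (hZ.pow_const 2) (b := 1) fun x => by
      rw [abs_pow]; exact pow_le_one₀ (abs_nonneg _) (h1 x)
  have hie : Integrable (fun x => Real.exp (Z x)) μ :=
    integrable_of_abs_le hZ.exp (b := Real.exp 1) fun x => by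
      rw [Real.abs_exp]; exact Real.exp_le_exp.2 ((le_abs_self _).trans (h1 x))
  rw [← ofReal_integral_eq_lintegral_ofReal hie
    (Filter.Eventually.of_forall fun x => Real.exp_nonneg _)]
  refine ENNReal.ofReal_le_ofReal ?_
  have h2 : ∫ x, Real.exp (Z x) ∂μ ≤ ∫ x, (1 + Z x + Z x ^ 2) ∂μ := by
    refine integral_mono hie (((integrable_const 1).add hiZ).add hiZ2) fun x => ?_
    have := (abs_le.1 (Real.abs_exp_sub_one_sub_id_le (h1 x))).2
    simp only; linarith
  have h3 : ∫ x, (1 + Z x + Z x ^ 2) ∂μ = ∫ x, (1 + Z x) ∂μ + ∫ x, Z x ^ 2 ∂μ :=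
    integral_add ((integrable_const 1).add hiZ) hiZ2
  rw [h3, integral_add (integrable_const 1) hiZ, h0] at h2
  simp only [integral_const, probReal_univ, smul_eq_mul] at h2
  linarith [Real.add_one_le_exp v]

/-- Exponential moment of the truncated martingale. Integrating out the last coordinate costs a
factor `exp(λ² C |I| B²)`, because the increment is centred given the past, its conditional variance
is at most `C |S_{<i}|²`, and it is bounded by `1 / |λ|`. -/
theorem lintegral_exp_sum_truncIncr_le [LinearOrder ι] [Fintype ι] [MeasurableSpace E]
    {μ : Measure E} [IsProbabilityMeasure μ]
    {w : κ → E → ℝ} (hw : ∀ k, Measurable (w k)) {I : Finset κ}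
    {b B C l : ℝ} (hb : ∀ k ∈ I, ∀ x, |w k x| ≤ b) (h0 : ∀ k ∈ I, ∫ x, w k x ∂μ = 0)
    (hC0 : 0 ≤ C) (hB0 : 0 ≤ B)
    (hC : ∀ a : κ → ℝ, ∫ x, (∑ k ∈ I, a k * w k x) ^ 2 ∂μ ≤ C * ∑ k ∈ I, a k ^ 2)
    (hl : |l| * (B * b * I.card) ≤ 1) (T : Finset ι) :
    ∫⁻ ω, ENNReal.ofReal (Real.exp (l * ∑ i ∈ T, truncIncr w I B T i ω)) ∂(Measure.pi fun _ => μ)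
      ≤ ENNReal.ofReal (Real.exp (T.card * (l ^ 2 * (C * (I.card * B ^ 2))))) := by
  classical
  induction T using Finset.induction_on_max with
  | empty => simp
  | insert a s has ih =>
    have ha : a ∉ s := fun h => lt_irrefl _ (has a h)
    set v := l ^ 2 * (C * (I.card * B ^ 2)) with hv
    have hsplit : ∀ ω : ι → E, ∑ i ∈ insert a s, truncIncr w I B (insert a s) i ω
        = truncIncr w I B s a ω + ∑ i ∈ s, truncIncr w I B s i ω := by
      intro ω
      rw [Finset.sum_insert ha, truncIncr_insert_of_le le_rfl]
      congr 1
      exact Finset.sum_congr rfl fun i hi => truncIncr_insert_of_le (has i hi).le ω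
    have hmeas : Measurable fun ω : ι → E => ∑ i ∈ s, truncIncr w I B s i ω :=
      Finset.measurable_sum _ fun i _ => measurable_truncIncr hw I B s i
    have hstep : ∀ ω : ι → E, ∫⁻ x, ENNReal.ofReal
        (Real.exp (l * truncIncr w I B s a (Function.update ω a x))) ∂μ
          ≤ ENNReal.ofReal (Real.exp v) := by
      intro ω
      by_cases hG : ∀ k ∈ I, |prefixSum (w k) s a ω| ≤ B
      · have heq : ∀ x, truncIncr w I B s a (Function.update ω a x)
            = ∑ k ∈ I, prefixSum (w k) s a ω * w k x := by
          intro x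
          unfold truncIncr
          simp only [prefixSum_update le_rfl, Function.update_self, if_pos hG]
        simp only [heq]
        refine lintegral_exp_le ?_ ?_ ?_ ?_
        · exact (Finset.measurable_sum _ fun k _ => (hw k).const_mul _).const_mul _
        · intro x
          rw [abs_mul]
          refine le_trans (mul_le_mul_of_nonneg_left ?_ (abs_nonneg l)) hl
          calc |∑ k ∈ I, prefixSum (w k) s a ω * w k x|
              ≤ ∑ k ∈ I, |prefixSum (w k) s a ω * w k x| := Finset.abs_sum_le_sum_abs _ _
            _ ≤ ∑ _k ∈ I, B * b := Finset.sum_le_sum fun k hk => by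
                rw [abs_mul]; exact mul_le_mul (hG k hk) (hb k hk x) (abs_nonneg _) hB0
            _ = B * b * I.card := by rw [Finset.sum_const, nsmul_eq_mul]; ring
        · rw [integral_const_mul, integral_finsetSum _ fun k hk =>
            (integrable_of_abs_le (hw k) (hb k hk)).const_mul _]
          rw [Finset.sum_eq_zero, mul_zero]
          intro k hk
          rw [integral_const_mul, h0 k hk, mul_zero]
        · simp only [mul_pow]
          rw [integral_const_mul, hv]
          refine mul_le_mul_of_nonneg_left ((hC _).trans ?_) (sq_nonneg l)
          refine mul_le_mul_of_nonneg_left ?_ hC0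
          calc ∑ k ∈ I, prefixSum (w k) s a ω ^ 2 ≤ ∑ _k ∈ I, B ^ 2 :=
                Finset.sum_le_sum fun k hk => by
                  rw [← sq_abs]; exact pow_le_pow_left₀ (abs_nonneg _) (hG k hk) 2
            _ = I.card * B ^ 2 := by rw [Finset.sum_const, nsmul_eq_mul]
      · have heq : ∀ x, truncIncr w I B s a (Function.update ω a x) = 0 := by
          intro x
          unfold truncIncr
          simp only [prefixSum_update le_rfl, if_neg hG]
        simp only [heq, mul_zero, Real.exp_zero, lintegral_const, measure_univ, mul_one]
        exact ENNReal.ofReal_le_ofReal (Real.one_le_exp (by positivity))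
    have hkey : ∫⁻ ω, ENNReal.ofReal (Real.exp (l * ∑ i ∈ insert a s,
          truncIncr w I B (insert a s) i ω)) ∂(Measure.pi fun _ => μ)
        ≤ ∫⁻ ω, ENNReal.ofReal (Real.exp v) * ENNReal.ofReal
          (Real.exp (l * ∑ i ∈ s, truncIncr w I B s i ω)) ∂(Measure.pi fun _ => μ) := by
      simp only [hsplit]
      refine lintegral_le_of_lmarginal_le {a} ?_ ?_ ?_
      · exact (((measurable_truncIncr hw I B s a).add hmeas).const_mul l).exp.ennreal_ofReal
      · exact (hmeas.const_mul l).exp.ennreal_ofReal.const_mul _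
      · rw [lmarginal_singleton, lmarginal_singleton]
        intro ω
        have hs : ∀ x, ∑ i ∈ s, truncIncr w I B s i (Function.update ω a x)
            = ∑ i ∈ s, truncIncr w I B s i ω := fun x =>
          Finset.sum_congr rfl fun i hi => truncIncr_update_of_lt (has i hi) ω x
        simp only [hs, mul_add, Real.exp_add, lintegral_const, measure_univ, mul_one,
          ENNReal.ofReal_mul (Real.exp_nonneg _)]
        rw [lintegral_mul_const' _ _ ENNReal.ofReal_ne_top]
        exact mul_le_mul_left (hstep ω) _
    refine hkey.trans ?_
    rw [lintegral_const_mul _ (hmeas.const_mul l).exp.ennreal_ofReal]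
    refine (mul_le_mul_right ih _).trans ?_
    rw [← ENNReal.ofReal_mul (Real.exp_nonneg _), ← Real.exp_add, Finset.card_insert_of_notMem ha]
    apply le_of_eq
    congr 2
    push_cast; ring

theorem sq_sum_eq_add_prefixSum [LinearOrder ι]
    (a : ι → ℝ) (T : Finset ι) :
    (∑ i ∈ T, a i) ^ 2 = ∑ i ∈ T, a i ^ 2 + 2 * ∑ i ∈ T, (∑ j ∈ T with j < i, a j) * a i := by
  classical
  induction T using Finset.induction_on_max with
  | empty => simp
  | insert c s hcs ih =>
    have hc : c ∉ s := fun h => lt_irrefl _ (hcs c h)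
    have h1 : ∑ i ∈ s, (∑ j ∈ insert c s with j < i, a j) * a i
        = ∑ i ∈ s, (∑ j ∈ s with j < i, a j) * a i :=
      Finset.sum_congr rfl fun i hi => by
        rw [Finset.filter_insert, if_neg (not_lt.2 (hcs i hi).le)]
    have h2 : (insert c s).filter (· < c) = s := by
      rw [Finset.filter_insert, if_neg (lt_irrefl c), Finset.filter_true_of_mem hcs]
    simp only [Finset.sum_insert hc, h2, h1, add_sq, ih]
    ring

theorem measure_sum_truncIncr_ge_le [LinearOrder ι] [Fintype ι] [MeasurableSpace E]
    {μ : Measure E} [IsProbabilityMeasure μ]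
    {w : κ → E → ℝ} (hw : ∀ k, Measurable (w k)) {I : Finset κ}
    {b B C l : ℝ} (hb : ∀ k ∈ I, ∀ x, |w k x| ≤ b) (h0 : ∀ k ∈ I, ∫ x, w k x ∂μ = 0)
    (hC0 : 0 ≤ C) (hB0 : 0 ≤ B)
    (hC : ∀ a : κ → ℝ, ∫ x, (∑ k ∈ I, a k * w k x) ^ 2 ∂μ ≤ C * ∑ k ∈ I, a k ^ 2)
    (hl : |l| * (B * b * I.card) ≤ 1) (T : Finset ι) {u t : ℝ}
    (ht : u + T.card * (l ^ 2 * (C * (I.card * B ^ 2))) ≤ t) :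
    (Measure.pi fun _ : ι => μ).real {ω | t ≤ l * ∑ i ∈ T, truncIncr w I B T i ω}
      ≤ Real.exp (-u) := by
  have hmeas : Measurable fun ω : ι → E => l * ∑ i ∈ T, truncIncr w I B T i ω :=
    (Finset.measurable_sum _ fun i _ => measurable_truncIncr hw I B T i).const_mul l
  have hL := lintegral_exp_sum_truncIncr_le (ι := ι) (μ := μ) hw hb h0 hC0 hB0 hC hl T
  set P := (Measure.pi fun _ : ι => μ)
  set v := (T.card : ℝ) * (l ^ 2 * (C * (I.card * B ^ 2)))
  have hM := mul_meas_ge_le_lintegral (μ := P) hmeas.exp.ennreal_ofReal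
    (ENNReal.ofReal (Real.exp t))
  have hset : {ω : ι → E | ENNReal.ofReal (Real.exp t) ≤
      ENNReal.ofReal (Real.exp (l * ∑ i ∈ T, truncIncr w I B T i ω))}
      = {ω | t ≤ l * ∑ i ∈ T, truncIncr w I B T i ω} := by
    ext ω
    simp [ENNReal.ofReal_le_ofReal_iff (Real.exp_nonneg _)]
  rw [hset] at hM
  have h2 := ENNReal.toReal_mono ENNReal.ofReal_ne_top (hM.trans hL)
  rw [ENNReal.toReal_mul, ENNReal.toReal_ofReal (Real.exp_nonneg _),
    ENNReal.toReal_ofReal (Real.exp_nonneg _)] at h2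
  change Real.exp t * P.real _ ≤ _ at h2
  have h3 : Real.exp v ≤ Real.exp t * Real.exp (-u) := by
    rw [← Real.exp_add]; exact Real.exp_le_exp.2 (by linarith)
  exact le_of_mul_le_mul_left (h2.trans h3) (Real.exp_pos t)

/-- On the event where no truncation occurs, the quadratic form is its diagonal part plus twice the
sum of the increments. -/
theorem sum_sq_eq_diag_add_truncIncr [LinearOrder ι] {w : κ → E → ℝ} {I : Finset κ} {B : ℝ}
    {T : Finset ι} {ω : ι → E} (h : ∀ i ∈ T, ∀ k ∈ I, |prefixSum (w k) T i ω| ≤ B) :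
    ∑ k ∈ I, (∑ i ∈ T, w k (ω i)) ^ 2
      = ∑ i ∈ T, ∑ k ∈ I, w k (ω i) ^ 2 + 2 * ∑ i ∈ T, truncIncr w I B T i ω := by
  simp only [sq_sum_eq_add_prefixSum (fun i => w _ (ω i)) T, Finset.sum_add_distrib,
    ← Finset.mul_sum]
  rw [Finset.sum_comm]
  congr 2
  rw [Finset.sum_comm]
  refine Finset.sum_congr rfl fun i hi => ?_
  unfold truncIncr
  rw [if_pos (h i hi)]
  rfl

/-- The arithmetic behind the choice of the exponent `1 / (b² r κ (σ + κ))` in the exponential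
Markov inequality, where `r = √(2 m u)`, `σ = √m` and `κ = √|I|`. -/
theorem exponent_le {b C r k s u : ℝ} (hb : 0 < b) (hC : 0 ≤ C) (hr : 0 < r) (hk : 0 < k)
    (hs : 0 < s) :
    u + s ^ 2 * ((1 / (b ^ 2 * r * k * (s + k))) ^ 2 * (C * (k ^ 2 * (b * r) ^ 2)))
      ≤ 1 / (b ^ 2 * r * k * (s + k)) * (u * b ^ 2 * r * k * (s + k) + C * s * r * k) := by
  have h1 : u + s ^ 2 * ((1 / (b ^ 2 * r * k * (s + k))) ^ 2 * (C * (k ^ 2 * (b * r) ^ 2)))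
      = u + C * s / (b ^ 2 * (s + k)) * (s / (s + k)) := by field_simp
  have h2 : 1 / (b ^ 2 * r * k * (s + k)) * (u * b ^ 2 * r * k * (s + k) + C * s * r * k)
      = u + C * s / (b ^ 2 * (s + k)) * 1 := by field_simp
  rw [h1, h2]
  gcongr
  rw [div_le_one (by positivity)]; linarith

theorem threshold_le {b C r k s u : ℝ} (hC : 0 ≤ C) (hr : 0 ≤ r) (hk : 0 ≤ k)
    (hs : 0 ≤ s) (hu : 1 ≤ u) (hr2 : r ^ 2 = 2 * s ^ 2 * u) :
    b ^ 2 * k ^ 2 * r + 2 * (u * b ^ 2 * r * k * (s + k) + C * s * r * k)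
      ≤ 5 * (b ^ 2 + C) * u ^ 2 * (s ^ 2 * k + s * k ^ 2) := by
  have hu0 : 0 < u := by linarith
  have hru : r ≤ 3 / 2 * s * u := by
    have : r ^ 2 ≤ (3 / 2 * s * u) ^ 2 := by
      rw [hr2]
      have := mul_le_mul_of_nonneg_left hu (by positivity : 0 ≤ s ^ 2 * u)
      linarith [sq_nonneg (s * u)]
    exact le_of_sq_le_sq this (by positivity)
  have hrus : u * r ≤ 3 / 2 * s * u ^ 2 := by
    linarith [mul_le_mul_of_nonneg_left hru hu0.le]
  have hrs : r ≤ 3 / 2 * s * u ^ 2 := by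
    linarith [mul_le_mul_of_nonneg_right hu hr]
  have hA : b ^ 2 * k ^ 2 * r ≤ b ^ 2 * k ^ 2 * (3 / 2 * s * u ^ 2) :=
    mul_le_mul_of_nonneg_left hrs (by positivity)
  have hB' : b ^ 2 * k * (s + k) * (u * r) ≤ b ^ 2 * k * (s + k) * (3 / 2 * s * u ^ 2) :=
    mul_le_mul_of_nonneg_left hrus (by positivity)
  have hC' : C * s * k * r ≤ C * s * k * (3 / 2 * s * u ^ 2) :=
    mul_le_mul_of_nonneg_left hrs (by positivity)
  have hp1 : 0 ≤ b ^ 2 * k ^ 2 * s * u ^ 2 := by positivity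
  have hp2 : 0 ≤ b ^ 2 * k * s ^ 2 * u ^ 2 := by positivity
  have hp3 : 0 ≤ C * k * s ^ 2 * u ^ 2 := by positivity
  have hp4 : 0 ≤ C * k ^ 2 * s * u ^ 2 := by positivity
  linarith

/-- Deviations of a quadratic form of sums of independent bounded variables whose covariance is
bounded by `C`. The order `|T| √|I|` of the main term is that of the standard deviation. -/
theorem measure_quadratic_deviation_le [LinearOrder ι] [Fintype ι] [MeasurableSpace E]
    {μ : Measure E} [IsProbabilityMeasure μ] {w : κ → E → ℝ} (hw : ∀ k, Measurable (w k))
    {I : Finset κ} (hI : I.Nonempty) {b C : ℝ} (hb0 : 0 < b) (hb : ∀ k ∈ I, ∀ x, |w k x| ≤ b)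
    (h0 : ∀ k ∈ I, ∫ x, w k x ∂μ = 0) (hC0 : 0 ≤ C)
    (hC : ∀ a : κ → ℝ, ∫ x, (∑ k ∈ I, a k * w k x) ^ 2 ∂μ ≤ C * ∑ k ∈ I, a k ^ 2)
    {T : Finset ι} (hT : T.Nonempty) {u : ℝ} (hu : 1 ≤ u) :
    (Measure.pi fun _ : ι => μ).real {ω |
        5 * (b ^ 2 + C) * u ^ 2 * (T.card * √I.card + √T.card * I.card) <
          |∑ k ∈ I, (∑ i ∈ T, w k (ω i)) ^ 2 - T.card * ∑ k ∈ I, ∫ x, w k x ^ 2 ∂μ|}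
      ≤ (2 * T.card * I.card + 4) * Real.exp (-u) := by
  classical
  set P := Measure.pi fun _ : ι => μ
  set m : ℝ := (T.card : ℝ) with hm
  set K : ℝ := (I.card : ℝ) with hK
  have hm0 : 0 < m := by rw [hm]; exact_mod_cast hT.card_pos
  have hK0 : 0 < K := by rw [hK]; exact_mod_cast hI.card_pos
  have hu0 : 0 < u := by linarith
  obtain ⟨r, hr⟩ : ∃ r, r = √(2 * m * u) := ⟨_, rfl⟩
  obtain ⟨s, hs⟩ : ∃ s, s = √m := ⟨_, rfl⟩
  obtain ⟨k, hk⟩ : ∃ k, k = √K := ⟨_, rfl⟩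
  have hr0 : 0 < r := by rw [hr]; positivity
  have hs0 : 0 < s := by rw [hs]; positivity
  have hk0 : 0 < k := by rw [hk]; positivity
  have hms : m = s ^ 2 := by rw [hs, Real.sq_sqrt hm0.le]
  have hKk : K = k ^ 2 := by rw [hk, Real.sq_sqrt hK0.le]
  have hr2 : r ^ 2 = 2 * s ^ 2 * u := by rw [hr, Real.sq_sqrt (by positivity), hms]
  obtain ⟨l, hl⟩ : ∃ l, l = 1 / (b ^ 2 * r * k * (s + k)) := ⟨_, rfl⟩
  have hl0 : 0 < l := by rw [hl]; positivity
  set B := b * r with hB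
  set t := u * b ^ 2 * r * k * (s + k) + C * s * r * k with ht
  have hlt : u + m * (l ^ 2 * (C * (K * B ^ 2))) ≤ l * t := by
    rw [hms, hKk, hl]; exact exponent_le hb0 hC0 hr0 hk0 hs0
  have hl1 : l * (B * b * K) ≤ 1 := by
    rw [hl, hKk, hB, one_div, inv_mul_le_iff₀ (by positivity)]
    nlinarith [mul_pos (mul_pos (mul_pos (pow_pos hb0 2) hr0) hk0) hs0]
  -- the diagonal part is a centred sum of terms bounded by `b² |I|`
  set v := ∑ k ∈ I, ∫ x, w k x ^ 2 ∂μ with hv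
  have hint : ∀ k ∈ I, Integrable (fun x => w k x ^ 2) μ := fun k hk =>
    integrable_of_abs_le ((hw k).pow_const 2) (b := b ^ 2) fun x => by
      rw [abs_pow]; exact pow_le_pow_left₀ (abs_nonneg _) (hb k hk x) 2
  have hsq : ∀ k ∈ I, ∀ x, w k x ^ 2 ≤ b ^ 2 := fun k hk x => by
    rw [← sq_abs]; exact pow_le_pow_left₀ (abs_nonneg _) (hb k hk x) 2
  set g : E → ℝ := fun x => ∑ k ∈ I, w k x ^ 2 - v with hg
  have hgm : Measurable g :=
    (Finset.measurable_sum _ fun k _ => (hw k).pow_const 2).sub measurable_const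
  have hg0 : ∫ x, g x ∂μ = 0 := by
    rw [hg, integral_sub (integrable_finsetSum _ hint) (integrable_const _),
      integral_finsetSum _ hint]
    simp [hv]
  have hv0 : 0 ≤ v := Finset.sum_nonneg fun k _ => integral_nonneg fun x => sq_nonneg _
  have hv1 : v ≤ b ^ 2 * K := by
    calc v ≤ ∑ _k ∈ I, b ^ 2 := Finset.sum_le_sum fun k hk => by
            refine (integral_mono (hint k hk) (integrable_const (b ^ 2)) (hsq k hk)).trans ?_
            simp
      _ = b ^ 2 * K := by rw [Finset.sum_const, nsmul_eq_mul, mul_comm]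
  have hgb : ∀ x, |g x| ≤ b ^ 2 * K := by
    intro x
    have h1 : 0 ≤ ∑ k ∈ I, w k x ^ 2 := Finset.sum_nonneg fun k _ => sq_nonneg _
    have h2 : ∑ k ∈ I, w k x ^ 2 ≤ b ^ 2 * K := by
      calc ∑ k ∈ I, w k x ^ 2 ≤ ∑ _k ∈ I, b ^ 2 := Finset.sum_le_sum fun k hk => hsq k hk x
        _ = b ^ 2 * K := by rw [Finset.sum_const, nsmul_eq_mul, mul_comm]
    rw [abs_le]; constructor <;> simp only [hg] <;> linarith
  -- off these events there is no truncation, and both parts of the quadratic form are small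
  set F1 : Set (ι → E) := ⋃ k ∈ I, ⋃ i ∈ T, {ω | B ≤ |prefixSum (w k) T i ω|}
  set F2 : Set (ι → E) := {ω | b ^ 2 * K * r ≤ |∑ i ∈ T, g (ω i)|}
  set F3 : Set (ι → E) := {ω | l * t ≤ l * ∑ i ∈ T, truncIncr w I B T i ω}
  set F4 : Set (ι → E) := {ω | l * t ≤ (-l) * ∑ i ∈ T, truncIncr w I B T i ω}
  have hF1 : P.real F1 ≤ 2 * m * K * Real.exp (-u) := by
    refine (measureReal_biUnion_finset_le I _).trans ?_
    calc ∑ k ∈ I, P.real (⋃ i ∈ T, {ω | B ≤ |prefixSum (w k) T i ω|})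
        ≤ ∑ _k ∈ I, ∑ _i ∈ T, 2 * Real.exp (-u) := by
          refine Finset.sum_le_sum fun k hk => (measureReal_biUnion_finset_le T _).trans ?_
          refine Finset.sum_le_sum fun i _ => ?_
          rw [hB, hr]
          exact measure_abs_sum_ge_le (hw k) hb0 (hb k hk) (h0 k hk) _
            (by rw [hm]; exact_mod_cast Finset.card_filter_le _ _) hm0 hu0
      _ = 2 * m * K * Real.exp (-u) := by
          rw [Finset.sum_const, Finset.sum_const, nsmul_eq_mul, nsmul_eq_mul, ← hm, ← hK]; ring
  have hF2 : P.real F2 ≤ 2 * Real.exp (-u) := by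
    have := measure_abs_sum_ge_le (ι := ι) hgm (mul_pos (pow_pos hb0 2) hK0) hgb hg0 T le_rfl hm0 hu0
    rwa [← hm, ← hr] at this
  have hF3 : P.real F3 ≤ Real.exp (-u) :=
    measure_sum_truncIncr_ge_le hw hb h0 hC0 (by positivity) hC
      (by rwa [abs_of_pos hl0]) T hlt
  have hF4 : P.real F4 ≤ Real.exp (-u) :=
    measure_sum_truncIncr_ge_le hw hb h0 hC0 (by positivity) hC
      (by rwa [abs_neg, abs_of_pos hl0]) T (by rwa [neg_sq])
  have hsub : {ω : ι → E | 5 * (b ^ 2 + C) * u ^ 2 * (m * √K + √m * K) <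
      |∑ k ∈ I, (∑ i ∈ T, w k (ω i)) ^ 2 - m * v|} ⊆ F1 ∪ F2 ∪ F3 ∪ F4 := by
    intro ω hω
    by_contra hcon
    simp only [Set.mem_union, not_or] at hcon
    obtain ⟨⟨⟨h1, h2⟩, h3⟩, h4⟩ := hcon
    have hG : ∀ i ∈ T, ∀ k ∈ I, |prefixSum (w k) T i ω| ≤ B := by
      intro i hi k hk
      by_contra hlt
      exact h1 (Set.mem_biUnion hk (Set.mem_biUnion hi (not_le.1 hlt).le))
    simp only [F2, F3, F4, Set.mem_ofPred_eq, not_le] at h2 h3 h4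
    rw [neg_mul, ← mul_neg] at h4
    have h3' := lt_of_mul_lt_mul_left h3 hl0.le
    have h4' := lt_of_mul_lt_mul_left h4 hl0.le
    have hgsum : ∑ i ∈ T, g (ω i) = ∑ i ∈ T, ∑ k ∈ I, w k (ω i) ^ 2 - m * v := by
      change ∑ i ∈ T, (∑ k ∈ I, w k (ω i) ^ 2 - v) = _
      rw [Finset.sum_sub_distrib, Finset.sum_const, nsmul_eq_mul]
    rw [Set.mem_ofPred_eq, sum_sq_eq_diag_add_truncIncr hG, add_sub_right_comm, ← hgsum, ← hs,
      ← hk, hms, hKk] at hω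
    rw [hKk] at h2
    have h5 : |∑ i ∈ T, g (ω i) + 2 * ∑ i ∈ T, truncIncr w I B T i ω|
        ≤ b ^ 2 * k ^ 2 * r + 2 * t := by
      rw [abs_lt] at h2
      rw [abs_le]; constructor <;> linarith
    have := threshold_le (b := b) hC0 hr0.le hk0.le hs0.le hu hr2
    rw [← ht] at this
    linarith
  have hun := (measureReal_mono hsub (measure_ne_top P _)).trans
    ((measureReal_union_le (μ := P) _ _).trans (add_le_add_left
      ((measureReal_union_le (μ := P) _ _).trans (add_le_add_left
        (measureReal_union_le (μ := P) _ _) _)) _))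
  linarith

end Chaos

/-! ### The cosine system -/

instance : IsProbabilityMeasure lebesgue01 := ⟨by simp [lebesgue01]⟩

theorem continuous_psi (j : ℕ) : Continuous (psi j) := by
  unfold psi
  split_ifs <;> fun_prop

theorem abs_psi_le (j : ℕ) (t : ℝ) : |psi j t| ≤ √2 := by
  unfold psi
  split_ifs
  · rw [abs_one]; exact Real.one_le_sqrt.2 one_le_two
  · rw [abs_mul, abs_of_nonneg (Real.sqrt_nonneg 2)]
    exact mul_le_of_le_one_right (Real.sqrt_nonneg 2) (Real.abs_cos_le_one _)

theorem psi_zero (t : ℝ) : psi 0 t = 1 := if_pos rfl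

theorem psi_of_pos {j : ℕ} (hj : 1 ≤ j) (t : ℝ) :
    psi j t = √2 * Real.cos (2 * Real.pi * j * t) := if_neg (by omega)

theorem psi_mul_psi_of_lt {j k : ℕ} (hk : 1 ≤ k) (h : k < j) (t : ℝ) :
    psi j t * psi k t = (psi (j + k) t + psi (j - k) t) / √2 := by
  rw [psi_of_pos (by omega), psi_of_pos hk, psi_of_pos (by omega), psi_of_pos (by omega),
    Nat.cast_sub h.le, Nat.cast_add]
  have h1 := Real.cos_add (2 * Real.pi * j * t) (2 * Real.pi * k * t)
  have h2 := Real.cos_sub (2 * Real.pi * j * t) (2 * Real.pi * k * t)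
  rw [show 2 * Real.pi * (j + k : ℝ) * t = 2 * Real.pi * j * t + 2 * Real.pi * k * t by ring,
    show 2 * Real.pi * (j - k : ℝ) * t = 2 * Real.pi * j * t - 2 * Real.pi * k * t by ring, h1, h2,
    eq_div_iff (by positivity)]
  linear_combination √2 * Real.cos (2 * Real.pi * j * t) * Real.cos (2 * Real.pi * k * t) *
    Real.mul_self_sqrt (zero_le_two (α := ℝ))

theorem psi_sq {j : ℕ} (hj : 1 ≤ j) (t : ℝ) : psi j t ^ 2 = 1 + psi (2 * j) t / √2 := by
  rw [psi_of_pos hj, psi_of_pos (by omega), mul_pow, Real.sq_sqrt zero_le_two,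
    mul_div_cancel_left₀ _ (by positivity), Nat.cast_mul,
    show 2 * Real.pi * ((2 : ℕ) * j : ℝ) * t = 2 * (2 * Real.pi * j * t) by push_cast; ring,
    Real.cos_two_mul]
  ring

theorem integrable_psi (j : ℕ) : Integrable (psi j) lebesgue01 :=
  integrable_of_abs_le (continuous_psi j).measurable (abs_psi_le j)

theorem integral_psi (j : ℕ) : ∫ t, psi j t ∂lebesgue01 = if j = 0 then 1 else 0 := by
  split_ifs with h
  · subst h; simp [psi_zero]
  · have hj : (1 : ℕ) ≤ j := by omega
    have hc : (2 * Real.pi * j : ℝ) ≠ 0 := by positivity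
    unfold lebesgue01
    rw [integral_Icc_eq_integral_Ioc, ← intervalIntegral.integral_of_le zero_le_one]
    simp only [psi_of_pos hj]
    rw [intervalIntegral.integral_const_mul, intervalIntegral.integral_comp_mul_left _ hc,
      integral_cos]
    have : Real.sin (2 * Real.pi * j) = 0 := by
      have := Real.sin_nat_mul_pi (2 * j)
      rw [← this]; congr 1; push_cast; ring
    simp [this]

theorem integral_psi_mul_psi (j k : ℕ) :
    ∫ t, psi j t * psi k t ∂lebesgue01 = if j = k then 1 else 0 := by
  wlog h : k ≤ j generalizing j k
  · have := this k j (by omega)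
    simp only [mul_comm (psi k _)] at this
    simp only [this, eq_comm]
  rcases Nat.eq_zero_or_pos k with rfl | hk
  · simp only [psi_zero, mul_one, integral_psi]
  rcases h.eq_or_lt with rfl | h
  · simp only [← sq, psi_sq hk]
    rw [integral_add (integrable_const _) ((integrable_psi _).div_const _), integral_div,
      integral_psi, if_neg (by omega)]
    simp
  · simp only [psi_mul_psi_of_lt hk h]
    rw [integral_div, integral_add (integrable_psi _) (integrable_psi _), integral_psi,
      integral_psi, if_neg (by omega), if_neg (by omega), if_neg (by omega)]
    simp

theorem memLp_psi (j : ℕ) : MemLp (psi j) 2 lebesgue01 :=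
  MemLp.of_bound (continuous_psi j).aestronglyMeasurable (√2)
    (Filter.Eventually.of_forall (abs_psi_le j))

section Density

variable {s : ℝ → ℝ}

theorem IsL2Density.integrable (hs : IsL2Density s) : Integrable s lebesgue01 :=
  hs.memLp.integrable (by norm_num)

theorem IsL2Density.integrable_mul_psi (hs : IsL2Density s) (j : ℕ) :
    Integrable (fun t => s t * psi j t) lebesgue01 :=
  hs.memLp.integrable_mul (memLp_psi j)

theorem theta_zero (hs : IsL2Density s) : theta s 0 = 1 := by
  simp [theta, psi_zero, hs.integral_eq_one]

theorem abs_theta_le (hs : IsL2Density s) (j : ℕ) : |theta s j| ≤ √2 := by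
  unfold theta
  refine abs_integral_le_integral_abs.trans ?_
  have h : ∫ t, |s t * psi j t| ∂lebesgue01 ≤ ∫ t, s t * √2 ∂lebesgue01 := by
    refine integral_mono_ae (hs.integrable_mul_psi j).abs (hs.integrable.mul_const _) ?_
    filter_upwards [hs.nonneg] with t ht
    rw [abs_mul, abs_of_nonneg ht]
    exact mul_le_mul_of_nonneg_left (abs_psi_le j t) ht
  rwa [integral_mul_const, hs.integral_eq_one, one_mul] at h

/-- Pythagorean identity for the distance from `s` to a trigonometric polynomial. -/
theorem integral_sq_sum_psi_sub (hs : IsL2Density s) (c : ℕ → ℝ) (k : ℕ) :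
    ∫ t, (∑ j ∈ Finset.range k, c j * psi j t - s t) ^ 2 ∂lebesgue01
      = ∫ t, s t ^ 2 ∂lebesgue01
        + ∑ j ∈ Finset.range k, ((c j - theta s j) ^ 2 - theta s j ^ 2) := by
  induction k with
  | zero => simp
  | succ k ih =>
    have hA : MemLp (fun t => ∑ j ∈ Finset.range k, c j * psi j t) 2 lebesgue01 :=
      memLp_finsetSum _ fun j _ => (memLp_psi j).const_mul (c j)
    have h1 : Integrable (fun t => (∑ j ∈ Finset.range k, c j * psi j t - s t) ^ 2) lebesgue01 :=
      (hA.sub hs.memLp).integrable_sq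
    have h2 : Integrable (fun t => psi k t ^ 2) lebesgue01 := (memLp_psi k).integrable_sq
    have h3 : Integrable (fun t => (∑ j ∈ Finset.range k, c j * psi j t) * psi k t) lebesgue01 :=
      hA.integrable_mul (memLp_psi k)
    have h4 := hs.integrable_mul_psi k
    have e : ∀ t, (∑ j ∈ Finset.range (k + 1), c j * psi j t - s t) ^ 2
        = (∑ j ∈ Finset.range k, c j * psi j t - s t) ^ 2 + c k ^ 2 * psi k t ^ 2
          + 2 * c k * ((∑ j ∈ Finset.range k, c j * psi j t) * psi k t)
          - 2 * c k * (s t * psi k t) := by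
      intro t; rw [Finset.sum_range_succ]; ring
    have i2 : ∫ t, psi k t ^ 2 ∂lebesgue01 = 1 := by
      simp only [sq, integral_psi_mul_psi, if_true]
    have i3 : ∫ t, (∑ j ∈ Finset.range k, c j * psi j t) * psi k t ∂lebesgue01 = 0 := by
      simp only [Finset.sum_mul, mul_assoc]
      have hi : ∀ j ∈ Finset.range k,
          Integrable (fun t => c j * (psi j t * psi k t)) lebesgue01 := fun j _ =>
        ((memLp_psi j).integrable_mul (memLp_psi k)).const_mul (c j)
      rw [integral_finsetSum _ hi]
      refine Finset.sum_eq_zero fun j hj => ?_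
      rw [integral_const_mul, integral_psi_mul_psi, if_neg (Finset.mem_range.1 hj).ne, mul_zero]
    simp only [e]
    rw [integral_sub ((h1.fun_add (h2.const_mul _)).fun_add (h3.const_mul _)) (h4.const_mul _),
      integral_add (h1.fun_add (h2.const_mul _)) (h3.const_mul _),
      integral_add h1 (h2.const_mul _), integral_const_mul, integral_const_mul,
      integral_const_mul, ih, i2, i3, Finset.sum_range_succ]
    unfold theta
    ring

/-- Bessel's inequality, in the form of summability. -/
theorem summable_theta_sq (hs : IsL2Density s) : Summable fun j => theta s j ^ 2 := by
  refine summable_of_sum_range_le (c := ∫ t, s t ^ 2 ∂lebesgue01) (fun j => sq_nonneg _) fun k => ?_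
  have h := integral_sq_sum_psi_sub hs (theta s) k
  have h0 : 0 ≤ ∫ t, (∑ j ∈ Finset.range k, theta s j * psi j t - s t) ^ 2 ∂lebesgue01 :=
    integral_nonneg fun t => sq_nonneg _
  rw [h] at h0
  simp only [sub_self, zero_pow two_ne_zero, zero_sub, Finset.sum_neg_distrib] at h0
  linarith

theorem tailSum_succ (hs : IsL2Density s) (k : ℕ) :
    tailSum s k = theta s (k + 1) ^ 2 + tailSum s (k + 1) := by
  unfold tailSum
  have hsum : Summable fun i => theta s (k + 1 + i) ^ 2 := by
    simpa [add_comm] using (summable_nat_add_iff (k + 1)).2 (summable_theta_sq hs)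
  rw [hsum.tsum_eq_zero_add]
  simp only [add_zero]
  congr 1
  refine tsum_congr fun i => ?_
  rw [show k + 1 + (i + 1) = k + 1 + 1 + i by ring]

theorem tailSum_eq_sum_add (hs : IsL2Density s) (k l : ℕ) :
    tailSum s k = ∑ i ∈ Finset.range l, theta s (k + 1 + i) ^ 2 + tailSum s (k + l) := by
  induction l with
  | zero => simp
  | succ l ih =>
    rw [ih, tailSum_succ hs (k + l), Finset.sum_range_succ]
    rw [show k + 1 + l = k + l + 1 by ring, ← add_assoc k l 1]
    ring

theorem tailSum_nonneg (s : ℝ → ℝ) (k : ℕ) : 0 ≤ tailSum s k := tsum_nonneg fun _ => sq_nonneg _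

theorem risk_succ {n : ℕ} (hs : IsL2Density s) (x : Fin n → ℝ) (T : Finset (Fin n)) (k : ℕ) :
    risk s x T (k + 1) - risk s x T k
      = (empMean x T (psi (k + 1)) - theta s (k + 1)) ^ 2 - theta s (k + 1) ^ 2 := by
  unfold risk estimator
  rw [integral_sq_sum_psi_sub hs (fun j => empMean x T (psi j)),
    integral_sq_sum_psi_sub hs (fun j => empMean x T (psi j)), Finset.sum_range_succ _ (k + 1)]
  ring

/-! ### Decay of the Fourier coefficients -/

theorem theta_sq_mul_le (hs : IsL2Density s) (hanti : Antitone fun j : ℕ => theta s j ^ 2)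
    (k : ℕ) : k * theta s (2 * k) ^ 2 ≤ tailSum s k := by
  rw [tailSum_eq_sum_add hs k k]
  have : ∑ _i ∈ Finset.range k, theta s (2 * k) ^ 2
      ≤ ∑ i ∈ Finset.range k, theta s (k + 1 + i) ^ 2 :=
    Finset.sum_le_sum fun i hi => hanti (by have := Finset.mem_range.1 hi; omega)
  rw [Finset.sum_const, Finset.card_range, nsmul_eq_mul] at this
  linarith [tailSum_nonneg s (k + k)]

/-- A non-increasing sequence of squares whose tail sums are `O(k⁻²)` is `O(k⁻³)`. -/
theorem theta_sq_le (hs : IsL2Density s) (hanti : Antitone fun j : ℕ => theta s j ^ 2)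
    {c₁ δ₁ : ℝ} (hc₁ : 0 ≤ c₁) (hδ₁ : 0 ≤ δ₁)
    (htail : ∀ k : ℕ, 1 ≤ k → tailSum s k ≤ c₁ / (k : ℝ) ^ (2 + δ₁)) {k : ℕ} (hk : 1 ≤ k) :
    theta s k ^ 2 ≤ (27 * c₁ + 1) / (k : ℝ) ^ 3 := by
  have hk0 : (0 : ℝ) < k := by exact_mod_cast hk
  rw [le_div_iff₀ (by positivity)]
  rcases hk.eq_or_lt with rfl | hk2
  · have := hanti (Nat.zero_le 1)
    simp only [theta_zero hs] at this
    rw [Nat.cast_one, one_pow, mul_one]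
    linarith
  set p := k / 2 with hp
  have hp1 : 1 ≤ p := by omega
  have hkp : (k : ℝ) ≤ 3 * p := by exact_mod_cast (by omega : k ≤ 3 * p)
  have hp0 : (1 : ℝ) ≤ p := by exact_mod_cast hp1
  have h1 : theta s k ^ 2 ≤ theta s (2 * p) ^ 2 := hanti (by omega)
  have h2 := theta_sq_mul_le hs hanti p
  have h3 := htail p hp1
  have h4 : c₁ / (p : ℝ) ^ (2 + δ₁) ≤ c₁ / (p : ℝ) ^ 2 := by
    gcongr
    rw [← Real.rpow_natCast]
    exact Real.rpow_le_rpow_of_exponent_le hp0 (by push_cast; linarith)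
  have h5 : p * theta s k ^ 2 ≤ c₁ / (p : ℝ) ^ 2 := by
    have := mul_le_mul_of_nonneg_left h1 (by positivity : (0 : ℝ) ≤ p)
    linarith
  rw [le_div_iff₀ (by positivity)] at h5
  have h6 : (k : ℝ) ^ 3 ≤ (3 * p) ^ 3 := by gcongr
  nlinarith [mul_le_mul_of_nonneg_left h6 (sq_nonneg (theta s k))]

theorem exists_sum_abs_theta_le (c : ℝ) : ∃ A : ℝ, 0 ≤ A ∧ ∀ s : ℝ → ℝ,
    (∀ k : ℕ, 1 ≤ k → theta s k ^ 2 ≤ c / (k : ℝ) ^ 3) →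
    ∀ F : Finset ℕ, 0 ∉ F → ∑ j ∈ F, |theta s j| ≤ A := by
  have hsum : Summable fun k : ℕ => √c * ((k : ℝ) ^ (3 / 2 : ℝ))⁻¹ :=
    (Real.summable_nat_rpow_inv.2 (by norm_num)).mul_left _
  refine ⟨∑' k : ℕ, √c * ((k : ℝ) ^ (3 / 2 : ℝ))⁻¹, tsum_nonneg fun k => mul_nonneg (Real.sqrt_nonneg c) (by positivity), fun s h F hF => ?_⟩
  refine le_trans (Finset.sum_le_sum fun j hj => ?_)
    (hsum.sum_le_tsum F fun k _ => mul_nonneg (Real.sqrt_nonneg c) (by positivity))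
  have hj1 : 1 ≤ j := Nat.one_le_iff_ne_zero.2 fun h0 => hF (h0 ▸ hj)
  have h3 : √((j : ℝ) ^ 3) = (j : ℝ) ^ (3 / 2 : ℝ) := by
    rw [Real.sqrt_eq_rpow, ← Real.rpow_natCast, ← Real.rpow_mul (by positivity)]
    norm_num
  have := Real.sqrt_le_sqrt (h j hj1)
  rwa [Real.sqrt_sq_eq_abs, Real.sqrt_div' _ (by positivity), div_eq_mul_inv, h3] at this

/-! ### The law of the observations -/

theorem isProbabilityMeasure_law (hs : IsL2Density s) : IsProbabilityMeasure (law s) := by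
  constructor
  rw [law, withDensity_apply _ MeasurableSet.univ, Measure.restrict_univ,
    ← ofReal_integral_eq_lintegral_ofReal hs.integrable hs.nonneg, hs.integral_eq_one,
    ENNReal.ofReal_one]

theorem integral_law (hs : IsL2Density s) (f : ℝ → ℝ) :
    ∫ t, f t ∂law s = ∫ t, s t * f t ∂lebesgue01 := by
  unfold law
  rw [integral_withDensity_eq_integral_toReal_smul₀
    hs.memLp.aestronglyMeasurable.aemeasurable.ennreal_ofReal
    (Filter.Eventually.of_forall fun _ => ENNReal.ofReal_lt_top)]
  refine integral_congr_ae ?_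
  filter_upwards [hs.nonneg] with t ht
  rw [ENNReal.toReal_ofReal ht, smul_eq_mul]

theorem integral_psi_law (hs : IsL2Density s) (j : ℕ) : ∫ t, psi j t ∂law s = theta s j :=
  integral_law hs _

theorem integrable_psi_law (hs : IsL2Density s) (j : ℕ) : Integrable (psi j) (law s) :=
  have := isProbabilityMeasure_law hs
  integrable_of_abs_le (continuous_psi j).measurable (abs_psi_le j)

theorem integrable_psi_mul_psi_law (hs : IsL2Density s) (j k : ℕ) :
    Integrable (fun t => psi j t * psi k t) (law s) :=
  have := isProbabilityMeasure_law hs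
  integrable_of_abs_le ((continuous_psi j).mul (continuous_psi k)).measurable (b := √2 * √2)
    fun t => by
      rw [abs_mul]
      exact mul_le_mul (abs_psi_le j t) (abs_psi_le k t) (abs_nonneg _) (Real.sqrt_nonneg _)

theorem integral_psi_sq_law (hs : IsL2Density s) {j : ℕ} (hj : 1 ≤ j) :
    ∫ t, psi j t ^ 2 ∂law s = 1 + theta s (2 * j) / √2 := by
  have := isProbabilityMeasure_law hs
  simp only [psi_sq hj]
  rw [integral_add (integrable_const _) ((integrable_psi_law hs _).div_const _), integral_div,
    integral_psi_law hs]
  simp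

theorem abs_integral_psi_mul_psi_law_le (hs : IsL2Density s) {j k : ℕ} (hj : 1 ≤ j) (hk : 1 ≤ k)
    (h : j ≠ k) :
    |∫ t, psi j t * psi k t ∂law s| ≤ |theta s (j + k)| + |theta s ((j - k) + (k - j))| := by
  wlog hlt : k < j generalizing j k
  · have := this hk hj h.symm (by omega)
    simp only [mul_comm (psi k _)] at this
    rwa [add_comm k j, add_comm (k - j)] at this
  simp only [psi_mul_psi_of_lt hk hlt]
  rw [integral_div, integral_add (integrable_psi_law hs _) (integrable_psi_law hs _),
    integral_psi_law hs, integral_psi_law hs, abs_div, abs_of_nonneg (Real.sqrt_nonneg 2),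
    Nat.sub_eq_zero_of_le hlt.le, add_zero]
  exact (div_le_self (abs_nonneg _) (Real.one_le_sqrt.2 one_le_two)).trans (abs_add_le _ _)

/-- Row sums of the Gram matrix of the cosine system in `L²(s(t) dt)`. -/
theorem sum_abs_integral_psi_mul_psi_law_le (hs : IsL2Density s) {A : ℝ}
    (hA : ∀ F : Finset ℕ, 0 ∉ F → ∑ j ∈ F, |theta s j| ≤ A) {I : Finset ℕ} (hI : 0 ∉ I) {j : ℕ}
    (hj : j ∈ I) :
    ∑ k ∈ I, |∫ t, psi j t * psi k t ∂law s| ≤ 1 + 4 * A := by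
  have pos : ∀ k ∈ I, 1 ≤ k := fun k hk => Nat.one_le_iff_ne_zero.2 fun h0 => hI (h0 ▸ hk)
  have inj : ∀ (J : Finset ℕ) (φ : ℕ → ℕ), Set.InjOn φ J → (∀ k ∈ J, φ k ≠ 0) →
      ∑ k ∈ J, |theta s (φ k)| ≤ A := by
    intro J φ hφ h0
    rw [← Finset.sum_image (f := fun i => |theta s i|) hφ]
    refine hA _ fun h => ?_
    obtain ⟨k, hk, hk0⟩ := Finset.mem_image.1 h
    exact h0 k hk hk0
  have hdiag : |∫ t, psi j t * psi j t ∂law s| ≤ 1 + A := by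
    simp only [← sq, integral_psi_sq_law hs (pos j hj)]
    refine (abs_add_le _ _).trans ?_
    rw [abs_one, abs_div, abs_of_nonneg (Real.sqrt_nonneg 2)]
    have h1 := hA {2 * j} (by have := pos j hj; simp; omega)
    rw [Finset.sum_singleton] at h1
    have h2 := div_le_self (abs_nonneg (theta s (2 * j))) (Real.one_le_sqrt.2 one_le_two)
    linarith
  have h1 := inj (I.erase j) (fun k => j + k) (fun a _ b _ h => by simpa using h)
    (fun k hk => by have := pos j hj; simp only [ne_eq]; omega)
  have h2 := inj ((I.erase j).filter (· < j)) (fun k => (j - k) + (k - j))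
    (fun a ha b hb h => by
      simp only [Finset.coe_filter, Set.mem_ofPred_eq] at ha hb; simp only at h; omega)
    (fun k hk => by have := (Finset.mem_filter.1 hk).2; simp only [ne_eq]; omega)
  have h3 := inj ((I.erase j).filter (¬ · < j)) (fun k => (j - k) + (k - j))
    (fun a ha b hb h => by
      simp only [Finset.coe_filter, Set.mem_ofPred_eq] at ha hb; simp only at h; omega)
    (fun k hk => by
      have h1 := (Finset.mem_filter.1 hk).2
      have h2 := Finset.ne_of_mem_erase (Finset.mem_filter.1 hk).1
      simp only [ne_eq]; omega)
  have h4 := Finset.sum_filter_add_sum_filter_not (I.erase j) (· < j)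
    (fun k => |theta s ((j - k) + (k - j))|)
  have h5 : ∑ k ∈ I.erase j, |∫ t, psi j t * psi k t ∂law s|
      ≤ ∑ k ∈ I.erase j, (|theta s (j + k)| + |theta s ((j - k) + (k - j))|) :=
    Finset.sum_le_sum fun k hk => abs_integral_psi_mul_psi_law_le hs (pos j hj)
      (pos k (Finset.mem_of_mem_erase hk)) (Finset.ne_of_mem_erase hk).symm
  rw [Finset.sum_add_distrib] at h5
  rw [← Finset.add_sum_erase I _ hj]
  linarith

/-- By Schur's test, the Gram matrix of the cosine system in `L²(s(t) dt)` is bounded on `ℓ²`. -/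
theorem integral_sq_sum_psi_law_le (hs : IsL2Density s) {A : ℝ}
    (hA : ∀ F : Finset ℕ, 0 ∉ F → ∑ j ∈ F, |theta s j| ≤ A) {I : Finset ℕ} (hI : 0 ∉ I)
    (a : ℕ → ℝ) :
    ∫ t, (∑ k ∈ I, a k * psi k t) ^ 2 ∂law s ≤ (1 + 4 * A) * ∑ k ∈ I, a k ^ 2 := by
  set G : ℕ → ℕ → ℝ := fun j k => ∫ t, psi j t * psi k t ∂law s with hG
  have hsymm : ∀ j k, G j k = G k j := fun j k => by simp only [hG, mul_comm]
  have hexp : ∫ t, (∑ k ∈ I, a k * psi k t) ^ 2 ∂law s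
      = ∑ j ∈ I, ∑ k ∈ I, a j * a k * G j k := by
    have e : ∀ t, (∑ k ∈ I, a k * psi k t) ^ 2
        = ∑ j ∈ I, ∑ k ∈ I, a j * a k * (psi j t * psi k t) := by
      intro t
      rw [sq, Finset.sum_mul_sum]
      exact Finset.sum_congr rfl fun j _ => Finset.sum_congr rfl fun k _ => by ring
    simp only [e]
    rw [integral_finsetSum _ fun j _ => integrable_finsetSum _ fun k _ =>
      (integrable_psi_mul_psi_law hs j k).const_mul _]
    refine Finset.sum_congr rfl fun j _ => ?_
    rw [integral_finsetSum _ fun k _ => (integrable_psi_mul_psi_law hs j k).const_mul _]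
    exact Finset.sum_congr rfl fun k _ => integral_const_mul _ _
  have h1 : ∀ j ∈ I, ∀ k ∈ I, a j * a k * G j k
      ≤ a j ^ 2 * |G j k| / 2 + a k ^ 2 * |G k j| / 2 := by
    intro j _ k _
    rw [hsymm k j]
    have h2 : a j * a k * G j k ≤ |a j| * |a k| * |G j k| := by
      rw [← abs_mul, ← abs_mul]; exact le_abs_self _
    have h3 : |a j| * |a k| ≤ (a j ^ 2 + a k ^ 2) / 2 := by
      rw [← sq_abs (a j), ← sq_abs (a k)]; linarith [sq_nonneg (|a j| - |a k|)]
    linarith [mul_le_mul_of_nonneg_right h3 (abs_nonneg (G j k))]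
  have h2 : ∑ j ∈ I, ∑ k ∈ I, a j ^ 2 * |G j k| ≤ (1 + 4 * A) * ∑ k ∈ I, a k ^ 2 := by
    rw [Finset.mul_sum]
    refine Finset.sum_le_sum fun j hj => ?_
    rw [← Finset.mul_sum, mul_comm]
    exact mul_le_mul_of_nonneg_right (sum_abs_integral_psi_mul_psi_law_le hs hA hI hj) (sq_nonneg _)
  rw [hexp]
  calc ∑ j ∈ I, ∑ k ∈ I, a j * a k * G j k
      ≤ ∑ j ∈ I, ∑ k ∈ I, (a j ^ 2 * |G j k| / 2 + a k ^ 2 * |G k j| / 2) :=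
        Finset.sum_le_sum fun j hj => Finset.sum_le_sum fun k hk => h1 j hj k hk
    _ = ∑ j ∈ I, ∑ k ∈ I, a j ^ 2 * |G j k| := by
        simp only [Finset.sum_add_distrib]
        rw [Finset.sum_comm (f := fun j k => a k ^ 2 * |G k j| / 2)]
        simp only [← Finset.sum_div]; ring
    _ ≤ _ := h2

/-- The centred basis function `ψ_k - θ_k`. -/
noncomputable def centredPsi (s : ℝ → ℝ) (k : ℕ) (t : ℝ) : ℝ := psi k t - theta s k

theorem measurable_centredPsi (s : ℝ → ℝ) (k : ℕ) : Measurable (centredPsi s k) :=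
  (continuous_psi k).measurable.sub_const _

theorem abs_centredPsi_le (hs : IsL2Density s) (k : ℕ) (t : ℝ) : |centredPsi s k t| ≤ 3 := by
  have h1 := abs_psi_le k t
  have h2 := abs_theta_le hs k
  have h3 : √2 ≤ 3 / 2 := by rw [Real.sqrt_le_left (by norm_num)]; norm_num
  exact (abs_sub _ _).trans (by linarith)

theorem integral_centredPsi (hs : IsL2Density s) (k : ℕ) : ∫ t, centredPsi s k t ∂law s = 0 := by
  have := isProbabilityMeasure_law hs
  unfold centredPsi
  rw [integral_sub (integrable_psi_law hs k) (integrable_const _), integral_psi_law hs]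
  simp

theorem integral_centredPsi_sq (hs : IsL2Density s) {k : ℕ} (hk : 1 ≤ k) :
    ∫ t, centredPsi s k t ^ 2 ∂law s = 1 + theta s (2 * k) / √2 - theta s k ^ 2 := by
  have := isProbabilityMeasure_law hs
  have e : ∀ t, centredPsi s k t ^ 2 = psi k t ^ 2 - 2 * theta s k * psi k t + theta s k ^ 2 :=
    fun t => by unfold centredPsi; ring
  have hi : Integrable (fun t => psi k t ^ 2) (law s) := by
    simpa only [sq] using integrable_psi_mul_psi_law hs k k
  simp only [e]
  rw [integral_add (hi.sub' ((integrable_psi_law hs k).const_mul _)) (integrable_const _),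
    integral_sub hi ((integrable_psi_law hs k).const_mul _), integral_const_mul,
    integral_psi_law hs, integral_psi_sq_law hs hk]
  simp; ring

theorem integral_sq_sum_centredPsi_le (hs : IsL2Density s) {A : ℝ}
    (hA : ∀ F : Finset ℕ, 0 ∉ F → ∑ j ∈ F, |theta s j| ≤ A) {I : Finset ℕ} (hI : 0 ∉ I)
    (a : ℕ → ℝ) :
    ∫ t, (∑ k ∈ I, a k * centredPsi s k t) ^ 2 ∂law s ≤ (1 + 4 * A) * ∑ k ∈ I, a k ^ 2 := by
  have := isProbabilityMeasure_law hs
  refine le_trans ?_ (integral_sq_sum_psi_law_le hs hA hI a)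
  set f : ℝ → ℝ := fun t => ∑ k ∈ I, a k * psi k t with hf
  have hfm : Continuous f := continuous_finsetSum _ fun k _ => (continuous_psi k).const_mul _
  have hfi : Integrable f (law s) :=
    integrable_finsetSum _ fun k _ => (integrable_psi_law hs k).const_mul _
  have hfi2 : Integrable (fun t => f t ^ 2) (law s) := by
    refine integrable_of_abs_le (hfm.pow 2).measurable (b := (∑ k ∈ I, |a k| * √2) ^ 2) fun t => ?_
    rw [abs_pow]
    refine pow_le_pow_left₀ (abs_nonneg _) ((Finset.abs_sum_le_sum_abs _ _).trans
      (Finset.sum_le_sum fun k _ => ?_)) 2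
    rw [abs_mul]
    exact mul_le_mul_of_nonneg_left (abs_psi_le k t) (abs_nonneg _)
  set c := ∑ k ∈ I, a k * theta s k with hc
  have hfc : ∫ t, f t ∂law s = c := by
    rw [hf, integral_finsetSum _ fun k _ => (integrable_psi_law hs k).const_mul _]
    exact Finset.sum_congr rfl fun k _ => by rw [integral_const_mul, integral_psi_law hs]
  have e : ∀ t, (∑ k ∈ I, a k * centredPsi s k t) ^ 2 = f t ^ 2 - 2 * c * f t + c ^ 2 := by
    intro t
    have : ∑ k ∈ I, a k * centredPsi s k t = f t - c := by
      simp only [centredPsi, mul_sub, Finset.sum_sub_distrib, hf, hc]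
    rw [this]; ring
  simp only [e]
  rw [integral_add (hfi2.sub' (hfi.const_mul _)) (integrable_const _),
    integral_sub hfi2 (hfi.const_mul _), integral_const_mul, hfc]
  simp only [integral_const, probReal_univ, smul_eq_mul, one_mul]
  linarith [sq_nonneg c]

end Density

/-! ### Linear interpolation -/

theorem linInterp_natCast (u : ℕ → ℝ) (k : ℕ) : linInterp u k = u k := by
  simp [linInterp]

/-- The interpolation of a convex sequence is the upper envelope of the lines through consecutive
points of its graph. -/
theorem le_linInterp {u : ℕ → ℝ} (hu : Monotone fun k => u (k + 1) - u k) {x : ℝ} (hx : 0 ≤ x)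
    (k : ℕ) : u k + (x - k) * (u (k + 1) - u k) ≤ linInterp u x := by
  have key : ∀ i, (u (i + 1) + (x - (i + 1 : ℕ)) * (u (i + 1 + 1) - u (i + 1)))
      - (u i + (x - i) * (u (i + 1) - u i))
      = (x - (i + 1)) * ((u (i + 1 + 1) - u (i + 1)) - (u (i + 1) - u i)) := by
    intro i; push_cast; ring
  have hfl : linInterp u x = u ⌊x⌋₊ + (x - ⌊x⌋₊) * (u (⌊x⌋₊ + 1) - u ⌊x⌋₊) := by
    unfold linInterp; ring
  rw [hfl]
  rcases le_total k ⌊x⌋₊ with h | h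
  · refine Nat.le_induction (P := fun i _ => i ≤ ⌊x⌋₊ → u k + (x - k) * (u (k + 1) - u k)
      ≤ u i + (x - i) * (u (i + 1) - u i)) (fun _ => le_rfl) ?_ _ h le_rfl
    intro i _ ih hi
    refine (ih (by omega)).trans ?_
    have h1 : ((i + 1 : ℕ) : ℝ) ≤ x := (Nat.cast_le.2 hi).trans (Nat.floor_le hx)
    push_cast at h1
    have := mul_nonneg (sub_nonneg.2 h1) (sub_nonneg.2 (hu (Nat.le_succ i)))
    simp only [Nat.succ_eq_add_one] at this
    linarith [key i]
  · refine Nat.le_induction (P := fun i _ => u i + (x - i) * (u (i + 1) - u i)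
      ≤ u ⌊x⌋₊ + (x - ⌊x⌋₊) * (u (⌊x⌋₊ + 1) - u ⌊x⌋₊)) le_rfl ?_ _ h
    intro i hi ih
    refine le_trans ?_ ih
    have h1 : x ≤ i + 1 := (Nat.lt_floor_add_one x).le.trans (by exact_mod_cast Nat.succ_le_succ hi)
    have := mul_nonneg (sub_nonneg.2 h1) (sub_nonneg.2 (hu (Nat.le_succ i)))
    simp only [Nat.succ_eq_add_one] at this
    linarith [key i]

theorem convexOn_linInterp {u : ℕ → ℝ} (hu : Monotone fun k => u (k + 1) - u k) :
    ConvexOn ℝ (Set.Ici 0) (linInterp u) := by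
  refine ⟨convex_Ici 0, fun x hx y hy a b ha hb hab => ?_⟩
  simp only [smul_eq_mul]
  set z := a * x + b * y with hz
  have h1 := mul_le_mul_of_nonneg_left (le_linInterp hu hx ⌊z⌋₊) ha
  have h2 := mul_le_mul_of_nonneg_left (le_linInterp hu hy ⌊z⌋₊) hb
  have h3 : linInterp u z = a * (u ⌊z⌋₊ + (x - ⌊z⌋₊) * (u (⌊z⌋₊ + 1) - u ⌊z⌋₊))
      + b * (u ⌊z⌋₊ + (y - ⌊z⌋₊) * (u (⌊z⌋₊ + 1) - u ⌊z⌋₊)) := by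
    have hb' : b = 1 - a := by linarith
    unfold linInterp
    rw [show (1 + ⌊z⌋₊ - z) * u ⌊z⌋₊ + (z - ⌊z⌋₊) * u (⌊z⌋₊ + 1)
      = u ⌊z⌋₊ + (a * x + b * y - ⌊z⌋₊) * (u (⌊z⌋₊ + 1) - u ⌊z⌋₊) by rw [← hz]; ring, hb']
    ring
  linarith

theorem abs_linInterp_le {u : ℕ → ℝ} {a b : ℕ} {M x : ℝ} (hu : ∀ k, a ≤ k → k ≤ b → |u k| ≤ M)
    (ha : a ≤ x) (hb : x ≤ b) : |linInterp u x| ≤ M := by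
  have hx : 0 ≤ x := (Nat.cast_nonneg a).trans ha
  have hfa : a ≤ ⌊x⌋₊ := Nat.le_floor ha
  have hfx := Nat.floor_le hx
  have hfb : ⌊x⌋₊ ≤ b := Nat.floor_le_of_le hb
  rcases hfb.eq_or_lt with h | h
  · have hxb : x = b := le_antisymm hb (by rw [← h]; exact hfx)
    rw [hxb, linInterp_natCast]
    exact hu b (hfa.trans hfb) le_rfl
  · have h1 := hu _ hfa hfb
    have h2 := hu (⌊x⌋₊ + 1) (by omega) h
    have h3 := Nat.lt_floor_add_one x
    have h4 : 0 ≤ 1 + (⌊x⌋₊ : ℝ) - x := by linarith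
    have h5 : 0 ≤ x - (⌊x⌋₊ : ℝ) := by linarith
    unfold linInterp
    refine (abs_add_le _ _).trans ?_
    rw [abs_mul, abs_mul, abs_of_nonneg h4, abs_of_nonneg h5]
    have := mul_le_mul_of_nonneg_left h1 h4
    have := mul_le_mul_of_nonneg_left h2 h5
    linarith

section Density

variable {s : ℝ → ℝ}

theorem convexOn_fn (hs : IsL2Density s) (hanti : Antitone fun j : ℕ => theta s j ^ 2)
    (nt n : ℕ) :
    ConvexOn ℝ (Set.Ici (-(kStar s nt : ℝ) / delta s nt n)) (fn s nt n) := by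
  have hmono : Monotone fun k => tailSum s (k + 1) - tailSum s k := by
    intro k l hkl
    have h1 := hanti (Nat.succ_le_succ hkl)
    simp only [Nat.succ_eq_add_one] at h1 ⊢
    linarith [tailSum_succ hs k, tailSum_succ hs l]
  have hconv := convexOn_linInterp hmono
  have hdom : ∀ α ∈ Set.Ici (-(kStar s nt : ℝ) / delta s nt n),
      0 ≤ (kStar s nt : ℝ) + α * delta s nt n := by
    intro α hα
    rcases (Nat.cast_nonneg (α := ℝ) (delta s nt n)).eq_or_lt with h | h
    · rw [← h, mul_zero, add_zero]; positivity
    · have := (div_le_iff₀ h).1 hα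
      linarith
  refine ⟨convex_Ici _, fun x hx y hy a b ha hb hab => ?_⟩
  have h := hconv.2 (hdom x hx) (hdom y hy) ha hb hab
  simp only [smul_eq_mul] at h ⊢
  have harg : a * ((kStar s nt : ℝ) + x * delta s nt n) + b * ((kStar s nt : ℝ) + y * delta s nt n)
      = kStar s nt + (a * x + b * y) * delta s nt n := by
    linear_combination (kStar s nt : ℝ) * hab
  rw [harg] at h
  have he : 0 ≤ 1 / smallE s nt n := one_div_nonneg.2 (Real.sqrt_nonneg _)
  unfold fn
  have h2 := mul_le_mul_of_nonneg_left h he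
  have hb' : b = 1 - a := by linarith
  rw [hb'] at h2 ⊢
  refine le_trans (le_of_eq ?_) (le_trans (add_le_add_left h2 (1 / smallE s nt n *
    (- tailSum s (kStar s nt) + (a * x + (1 - a) * y) * delta s nt n / nt))) (le_of_eq ?_)) <;> ring

/-! ### The window `[a_x, b_x]` -/

theorem one_div_le_theta_kStar_sq (hs : IsL2Density s) {m : ℕ} (hm : 1 ≤ m)
    (hbdd : BddAbove {k : ℕ | 1 / (m : ℝ) ≤ theta s k ^ 2}) :
    1 / (m : ℝ) ≤ theta s (kStar s m) ^ 2 := by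
  refine Nat.sSup_mem (s := {k : ℕ | 1 / (m : ℝ) ≤ theta s k ^ 2}) ⟨0, ?_⟩ hbdd
  have : (1 : ℝ) ≤ m := by exact_mod_cast hm
  change 1 / (m : ℝ) ≤ theta s 0 ^ 2
  rw [theta_zero hs, one_pow, div_le_one (by positivity)]
  exact this

/-- If `θ_k² ≤ C k⁻³` and `θ_k² ≥ 1 / m`, then `k ≤ C m`. -/
theorem le_mul_of_one_div_le {C m q : ℝ} (hC : 0 ≤ C) (hm : 0 < m) {k : ℕ}
    (hθ : 1 ≤ k → q ≤ C / (k : ℝ) ^ 3) (h : 1 / m ≤ q) : (k : ℝ) ≤ C * m := by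
  rcases Nat.eq_zero_or_pos k with rfl | hk
  · simp; positivity
  have hk1 : (1 : ℝ) ≤ k := by exact_mod_cast hk
  have h1 := h.trans (hθ hk)
  rw [div_le_div_iff₀ hm (by positivity), one_mul] at h1
  exact (le_self_pow₀ hk1 (by norm_num)).trans h1

theorem bddAbove_of_cast_le {S : Set ℕ} {M : ℝ} (h : ∀ k ∈ S, (k : ℝ) ≤ M) : BddAbove S :=
  ⟨⌈M⌉₊, fun k hk => by exact_mod_cast (h k hk).trans (Nat.le_ceil M)⟩

theorem cast_le_of_mem_deltaD {C : ℝ} (hC : 0 ≤ C)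
    (hdec : ∀ k : ℕ, 1 ≤ k → theta s k ^ 2 ≤ C / (k : ℝ) ^ 3) {m n : ℕ} (hm : 1 ≤ m)
    (hN : 1 ≤ (n : ℝ) - m) {l : ℕ}
    (hl : (1 - √((m : ℝ) / ((n : ℝ) - m)) * (1 / √(l : ℝ))) * (1 / (m : ℝ))
      ≤ theta s (kStar s m + l) ^ 2) : (l : ℝ) ≤ (4 + 2 * C) * m := by
  have hm0 : (0 : ℝ) < m := by exact_mod_cast hm
  have hCm : 0 ≤ C * m := by positivity
  rcases le_total (l : ℝ) (4 * m) with h | h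
  · linarith
  have hl0 : (0 : ℝ) < l := by linarith
  have h1 : √((m : ℝ) / ((n : ℝ) - m)) ≤ √(l : ℝ) / 2 := by
    rw [Real.sqrt_le_left (by positivity), div_pow, Real.sq_sqrt hl0.le]
    have := div_le_self hm0.le hN
    linarith
  have h2 : √((m : ℝ) / ((n : ℝ) - m)) * (1 / √(l : ℝ)) ≤ 1 / 2 := by
    have : 0 < √(l : ℝ) := Real.sqrt_pos.2 hl0
    rw [mul_one_div, div_le_iff₀ this]; linarith
  have h3 : 1 / (2 * m : ℝ) ≤ theta s (kStar s m + l) ^ 2 := by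
    refine le_trans ?_ hl
    rw [show 1 / (2 * m : ℝ) = 1 / 2 * (1 / m) by field_simp]
    exact mul_le_mul_of_nonneg_right (by linarith) (by positivity)
  have h4 := le_mul_of_one_div_le (k := kStar s m + l) hC (by positivity) (hdec _) h3
  push_cast at h4
  have : (0 : ℝ) ≤ kStar s m := by positivity
  linarith

theorem deltaG_le_kStar (s : ℝ → ℝ) (m n : ℕ) : deltaG s m n ≤ kStar s m := by
  unfold deltaG
  rcases Set.eq_empty_or_nonempty {l : ℕ | 1 ≤ l ∧ l ≤ kStar s m ∧
    (1 + √((m : ℝ) / ((n : ℝ) - m)) * (1 / √(l : ℝ))) * (1 / (m : ℝ))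
      ≤ theta s (kStar s m - l) ^ 2} with h | h
  · rw [h, Nat.sInf_empty]; exact Nat.zero_le _
  · exact (Nat.sInf_mem h).2.1

/-- `𝔢 · f_n` at the grid point that corresponds to the model `k`. -/
theorem smallE_mul_fn {m n : ℕ} (he : smallE s m n ≠ 0) {α : ℝ}
    {k : ℕ} (hk : (kStar s m : ℝ) + α * delta s m n = k) :
    smallE s m n * fn s m n α = tailSum s k - tailSum s (kStar s m)
      + ((k : ℝ) - kStar s m) / m := by
  unfold fn
  rw [hk, linInterp_natCast, ← hk, ← mul_assoc, mul_one_div_cancel he, one_mul]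
  ring

theorem tailSum_sub_of_le (hs : IsL2Density s) {k j : ℕ} (hj : j ≤ k) :
    tailSum s (k - j) - tailSum s k = ∑ i ∈ Finset.range j, theta s (k - i) ^ 2 := by
  induction j with
  | zero => simp
  | succ j ih =>
    rw [Finset.sum_range_succ, ← ih (by omega), tailSum_succ hs (k - (j + 1)),
      show k - (j + 1) + 1 = k - j by omega]
    ring

theorem mul_le_sum_of_le {g : ℕ → ℝ} {j d : ℕ} {c : ℝ} (hc0 : 0 ≤ c) (h0 : ∀ i < j, 0 ≤ g i)
    (hc : ∀ i < j, d ≤ i → c ≤ g i) : ((j : ℝ) - d) * c ≤ ∑ i ∈ Finset.range j, g i := by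
  induction j with
  | zero =>
    have : 0 ≤ (d : ℝ) * c := by positivity
    simp; linarith
  | succ j ih =>
    rcases le_or_gt d j with h | h
    · have := ih (fun i hi => h0 i (by omega)) (fun i hi => hc i (by omega))
      rw [Finset.sum_range_succ]
      push_cast
      linarith [hc j (by omega) h]
    · have h1 : ((j + 1 : ℕ) : ℝ) ≤ d := by exact_mod_cast h
      have h2 : 0 ≤ ∑ i ∈ Finset.range (j + 1), g i :=
        Finset.sum_nonneg fun i hi => h0 i (Finset.mem_range.1 hi)
      nlinarith

theorem smallE_eq {m n : ℕ} (hN : 0 < (n : ℝ) - m) :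
    smallE s m n = √(delta s m n : ℝ) / (√(m : ℝ) * √((n : ℝ) - m)) := by
  unfold smallE bigE
  rw [Real.sqrt_div' _ hN.le, Real.sqrt_div' _ (Nat.cast_nonneg m), div_div]

/-- The margin `√(n_t / (n - n_t)) / (√(Δ+1) n_t)` beyond `Δ` in the definition of `Δ_d` and `Δ_g` is
comparable to `𝔢 / Δ`. -/
theorem le_of_sub_mul_le {m n : ℕ} (hm : 1 ≤ m) (hN : 0 < (n : ℝ) - m) (hΔ : 1 ≤ delta s m n)
    {j x : ℝ} (hx : 0 ≤ x)
    (h : (j - delta s m n) * (√((m : ℝ) / ((n : ℝ) - m)) * (1 / √((delta s m n : ℝ) + 1))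
      * (1 / (m : ℝ))) ≤ smallE s m n * x) :
    j ≤ (1 + 2 * x) * delta s m n := by
  rw [smallE_eq hN, Real.sqrt_div' _ hN.le] at h
  have hD0 : (1 : ℝ) ≤ delta s m n := by exact_mod_cast hΔ
  have hm0 : (0 : ℝ) < m := by exact_mod_cast hm
  set D : ℝ := (delta s m n : ℝ)
  have hσ : 0 < √(m : ℝ) := Real.sqrt_pos.2 hm0
  have hν : 0 < √((n : ℝ) - m) := Real.sqrt_pos.2 hN
  have hd : 0 < √D := Real.sqrt_pos.2 (by linarith)
  have hd' : 0 < √(D + 1) := Real.sqrt_pos.2 (by linarith)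
  have hms : (m : ℝ) = √(m : ℝ) ^ 2 := (Real.sq_sqrt hm0.le).symm
  have hDs : √D ^ 2 = D := Real.sq_sqrt (by linarith)
  have hdd : √(D + 1) ≤ 2 * √D := by
    rw [Real.sqrt_le_left (by positivity), mul_pow, hDs]; linarith
  generalize √(m : ℝ) = σ at *
  generalize √((n : ℝ) - m) = ν at *
  rw [hms, show σ / ν * (1 / √(D + 1)) * (1 / σ ^ 2) = 1 / (σ * ν * √(D + 1)) by field_simp,
    mul_one_div, div_le_iff₀ (by positivity),
    show √D / (σ * ν) * x * (σ * ν * √(D + 1)) = x * √D * √(D + 1) by field_simp] at h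
  have := mul_le_mul_of_nonneg_left hdd (by positivity : 0 ≤ x * √D)
  have h3 : x * √D * (2 * √D) = 2 * x * D := by linear_combination 2 * x * hDs
  linarith

section Window

variable {C : ℝ} {m n : ℕ}

theorem bddAbove_kStar (hC : 0 ≤ C) (hdec : ∀ k : ℕ, 1 ≤ k → theta s k ^ 2 ≤ C / (k : ℝ) ^ 3)
    (hm : 1 ≤ m) : BddAbove {k : ℕ | 1 / (m : ℝ) ≤ theta s k ^ 2} :=
  bddAbove_of_cast_le fun k hk =>
    le_mul_of_one_div_le hC (by exact_mod_cast hm) (hdec k) hk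

theorem kStar_le (hs : IsL2Density s) (hC : 0 ≤ C)
    (hdec : ∀ k : ℕ, 1 ≤ k → theta s k ^ 2 ≤ C / (k : ℝ) ^ 3) (hm : 1 ≤ m) :
    (kStar s m : ℝ) ≤ C * m :=
  le_mul_of_one_div_le hC (by exact_mod_cast hm) (hdec _)
    (one_div_le_theta_kStar_sq hs hm (bddAbove_kStar hC hdec hm))

theorem delta_le (hs : IsL2Density s) (hC : 0 ≤ C)
    (hdec : ∀ k : ℕ, 1 ≤ k → theta s k ^ 2 ≤ C / (k : ℝ) ^ 3) (hm : 1 ≤ m)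
    (hN : 1 ≤ (n : ℝ) - m) : (delta s m n : ℝ) ≤ (4 + 2 * C) * m := by
  have hm0 : (0 : ℝ) < m := by exact_mod_cast hm
  have hCm : 0 ≤ C * m := by positivity
  unfold delta
  rw [Nat.cast_max]
  refine max_le ?_ ?_
  · refine cast_le_of_mem_deltaD hC hdec hm hN (l := deltaD s m n) ?_
    refine Nat.sSup_mem (s := {l : ℕ | (1 - √((m : ℝ) / ((n : ℝ) - m)) * (1 / √(l : ℝ)))
      * (1 / (m : ℝ)) ≤ theta s (kStar s m + l) ^ 2}) ⟨0, ?_⟩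
      (bddAbove_of_cast_le fun l hl => cast_le_of_mem_deltaD hC hdec hm hN hl)
    simpa using one_div_le_theta_kStar_sq hs hm (bddAbove_kStar hC hdec hm)
  · have h1 := kStar_le hs hC hdec hm
    have h2 : (deltaG s m n : ℝ) ≤ kStar s m := by exact_mod_cast deltaG_le_kStar s m n
    linarith

/-- Beyond `k_* + Δ` every further model costs at least `√(n_t / (n - n_t)) / (√(Δ+1) n_t)`, by
maximality of `Δ_d`. -/
theorem le_of_fn_le_right (hs : IsL2Density s) (hanti : Antitone fun j : ℕ => theta s j ^ 2)
    (hC : 0 ≤ C) (hdec : ∀ k : ℕ, 1 ≤ k → theta s k ^ 2 ≤ C / (k : ℝ) ^ 3) (hm : 1 ≤ m)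
    (hN : 1 ≤ (n : ℝ) - m) (hΔ : 1 ≤ delta s m n) {x : ℝ} (hx : 0 ≤ x) {j : ℕ}
    (h : fn s m n ((j : ℝ) / delta s m n) ≤ x) : (j : ℝ) ≤ (1 + 2 * x) * delta s m n := by
  have hm0 : (0 : ℝ) < m := by exact_mod_cast hm
  have hD0 : (0 : ℝ) < delta s m n := by exact_mod_cast hΔ
  have he : 0 < smallE s m n := by
    rw [smallE_eq (by linarith)]
    have : 0 < (n : ℝ) - m := by linarith
    positivity
  refine le_of_sub_mul_le hm (by linarith) hΔ hx (le_trans ?_ (mul_le_mul_of_nonneg_left h he.le))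
  rw [smallE_mul_fn he.ne' (k := kStar s m + j) (by rw [div_mul_cancel₀ _ hD0.ne']; push_cast; rfl)]
  have h1 := tailSum_eq_sum_add hs (kStar s m) j
  have h2 : tailSum s (kStar s m + j) - tailSum s (kStar s m)
      + (((kStar s m + j : ℕ) : ℝ) - kStar s m) / m
      = ∑ i ∈ Finset.range j, (1 / (m : ℝ) - theta s (kStar s m + 1 + i) ^ 2) := by
    rw [h1, Finset.sum_sub_distrib, Finset.sum_const, Finset.card_range, nsmul_eq_mul]
    push_cast; ring
  rw [h2]
  refine mul_le_sum_of_le (by positivity) (fun i _ => ?_) (fun i _ hi => ?_)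
  · have : kStar s m + 1 + i ∉ {k : ℕ | 1 / (m : ℝ) ≤ theta s k ^ 2} :=
      notMem_of_csSup_lt (by unfold kStar; omega) (bddAbove_kStar hC hdec hm)
    exact sub_nonneg.2 (not_le.1 this).le
  · have hlt : deltaD s m n < delta s m n + 1 := Nat.lt_succ_of_le (le_max_left _ _)
    have hnot : delta s m n + 1 ∉ {l : ℕ | (1 - √((m : ℝ) / ((n : ℝ) - m)) * (1 / √(l : ℝ)))
        * (1 / (m : ℝ)) ≤ theta s (kStar s m + l) ^ 2} :=
      notMem_of_csSup_lt hlt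
        (bddAbove_of_cast_le fun l hl => cast_le_of_mem_deltaD hC hdec hm hN hl)
    have h3 : theta s (kStar s m + (delta s m n + 1)) ^ 2
        < (1 - √((m : ℝ) / ((n : ℝ) - m)) * (1 / √((delta s m n + 1 : ℕ) : ℝ))) * (1 / (m : ℝ)) :=
      not_le.1 fun hcon => hnot hcon
    have h4 : theta s (kStar s m + 1 + i) ^ 2 ≤ theta s (kStar s m + (delta s m n + 1)) ^ 2 :=
      hanti (by omega)
    push_cast at h3
    linarith

/-- Below `k_* - Δ` every further step costs at least `√(n_t / (n - n_t)) / (√Δ n_t)`. When no index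
qualifies in the definition of `Δ_g`, the value `θ_0 = 1` forces `n_t ≤ 2`, so that `k_*` is bounded. -/
theorem le_of_fn_le_left (hs : IsL2Density s) (hanti : Antitone fun j : ℕ => theta s j ^ 2)
    (hC : 0 ≤ C) (hdec : ∀ k : ℕ, 1 ≤ k → theta s k ^ 2 ≤ C / (k : ℝ) ^ 3) (hm : 1 ≤ m)
    (hN : 1 ≤ (n : ℝ) - m) (hΔ : 1 ≤ delta s m n) {x : ℝ} (hx : 0 ≤ x) {j : ℕ}
    (hj : j ≤ kStar s m) (h : fn s m n (-(j : ℝ) / delta s m n) ≤ x) :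
    (j : ℝ) ≤ (1 + 2 * C + 2 * x) * delta s m n := by
  have hm0 : (0 : ℝ) < m := by exact_mod_cast hm
  have hD1 : (1 : ℝ) ≤ delta s m n := by exact_mod_cast hΔ
  have hD0 : (0 : ℝ) < delta s m n := by linarith
  have hj' : (j : ℝ) ≤ kStar s m := by exact_mod_cast hj
  have hk0 := one_div_le_theta_kStar_sq hs hm (bddAbove_kStar hC hdec hm)
  rcases Set.eq_empty_or_nonempty {l : ℕ | 1 ≤ l ∧ l ≤ kStar s m ∧
    (1 + √((m : ℝ) / ((n : ℝ) - m)) * (1 / √(l : ℝ))) * (1 / (m : ℝ))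
      ≤ theta s (kStar s m - l) ^ 2} with hemp | hne
  · rcases Nat.eq_zero_or_pos (kStar s m) with hk | hk
    · have : j = 0 := by omega
      subst this
      rw [Nat.cast_zero]; positivity
    have hnot : kStar s m ∉ {l : ℕ | 1 ≤ l ∧ l ≤ kStar s m ∧
      (1 + √((m : ℝ) / ((n : ℝ) - m)) * (1 / √(l : ℝ))) * (1 / (m : ℝ))
        ≤ theta s (kStar s m - l) ^ 2} := by rw [hemp]; exact Set.notMem_empty _
    have h1 : theta s (kStar s m - kStar s m) ^ 2
        < (1 + √((m : ℝ) / ((n : ℝ) - m)) * (1 / √(kStar s m : ℝ))) * (1 / (m : ℝ)) := by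
      by_contra hcon
      exact hnot ⟨hk, le_rfl, not_lt.1 hcon⟩
    rw [Nat.sub_self, theta_zero hs, one_pow, mul_one_div, lt_div_iff₀ hm0, one_mul] at h1
    have h2 : √((m : ℝ) / ((n : ℝ) - m)) ≤ √(m : ℝ) :=
      Real.sqrt_le_sqrt (div_le_self hm0.le hN)
    have h3 : 1 / √(kStar s m : ℝ) ≤ 1 := by
      have : 1 ≤ √(kStar s m : ℝ) := Real.one_le_sqrt.2 (by exact_mod_cast hk)
      exact (div_le_one (by linarith)).2 this
    have h4 : √((m : ℝ) / ((n : ℝ) - m)) * (1 / √(kStar s m : ℝ)) ≤ √(m : ℝ) :=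
      (mul_le_of_le_one_right (Real.sqrt_nonneg _) h3).trans h2
    have hm2 : (m : ℝ) ≤ 2 := by
      by_contra hcon
      have h5 : 3 ≤ m := by
        have : 2 < m := by exact_mod_cast not_le.1 hcon
        omega
      have h6 : (3 : ℝ) ≤ m := by exact_mod_cast h5
      have h7 : √(m : ℝ) ≤ m - 1 := by
        rw [Real.sqrt_le_left (by linarith)]; nlinarith
      linarith
    have h8 := kStar_le hs hC hdec hm
    have h9 : C * m ≤ C * 2 := mul_le_mul_of_nonneg_left hm2 hC
    have h10 : 2 * C * 1 ≤ 2 * C * delta s m n := by gcongr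
    have h11 : 0 ≤ (1 + 2 * x) * delta s m n := by positivity
    linarith
  · have hmem := Nat.sInf_mem hne
    change _ ∧ _ ∧ _ at hmem
    change 1 ≤ deltaG s m n ∧ deltaG s m n ≤ kStar s m ∧
      (1 + √((m : ℝ) / ((n : ℝ) - m)) * (1 / √(deltaG s m n : ℝ))) * (1 / (m : ℝ))
        ≤ theta s (kStar s m - deltaG s m n) ^ 2 at hmem
    obtain ⟨hg1, -, hg⟩ := hmem
    have he : 0 < smallE s m n := by
      rw [smallE_eq (by linarith)]
      have : 0 < (n : ℝ) - m := by linarith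
      positivity
    have hCD : 0 ≤ 2 * C * delta s m n := by positivity
    suffices (j : ℝ) ≤ (1 + 2 * x) * delta s m n by linarith
    refine le_of_sub_mul_le hm (by linarith) hΔ hx
      (le_trans ?_ (mul_le_mul_of_nonneg_left h he.le))
    rw [smallE_mul_fn he.ne' (k := kStar s m - j)
      (by rw [div_mul_cancel₀ _ hD0.ne', Nat.cast_sub hj]; ring), tailSum_sub_of_le hs hj,
      Nat.cast_sub hj]
    have h2 : ∑ i ∈ Finset.range j, theta s (kStar s m - i) ^ 2
        + ((kStar s m : ℝ) - j - kStar s m) / m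
        = ∑ i ∈ Finset.range j, (theta s (kStar s m - i) ^ 2 - 1 / (m : ℝ)) := by
      rw [Finset.sum_sub_distrib, Finset.sum_const, Finset.card_range, nsmul_eq_mul]
      ring
    rw [h2]
    refine mul_le_sum_of_le (by positivity) (fun i _ => ?_) (fun i _ hi => ?_)
    · exact sub_nonneg.2 (hk0.trans (hanti (Nat.sub_le _ _)))
    · have hgi : deltaG s m n ≤ i := (le_max_right _ _).trans hi
      have h3 : theta s (kStar s m - deltaG s m n) ^ 2 ≤ theta s (kStar s m - i) ^ 2 :=
        hanti (by omega)
      have h4 : 1 / √((delta s m n : ℝ) + 1) ≤ 1 / √(deltaG s m n : ℝ) := by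
        have : 0 < √(deltaG s m n : ℝ) := Real.sqrt_pos.2 (by exact_mod_cast hg1)
        refine one_div_le_one_div_of_le this (Real.sqrt_le_sqrt ?_)
        have : (deltaG s m n : ℝ) ≤ delta s m n := by exact_mod_cast le_max_right _ _
        linarith
      have h5 := mul_le_mul_of_nonneg_right (mul_le_mul_of_nonneg_left h4
        (Real.sqrt_nonneg ((m : ℝ) / ((n : ℝ) - m)))) (by positivity : 0 ≤ 1 / (m : ℝ))
      linarith

theorem fn_zero (s : ℝ → ℝ) (m n : ℕ) : fn s m n 0 = 0 := by
  simp [fn, linInterp_natCast]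

theorem exists_upperEnd_eq (hΔ : 1 ≤ delta s m n) {x W : ℝ} (hx : 0 ≤ x)
    (hW : ∀ j : ℕ, fn s m n ((j : ℝ) / delta s m n) ≤ x → (j : ℝ) ≤ W) :
    ∃ j : ℕ, (j : ℝ) ≤ W ∧ upperEnd s m n x = (j : ℝ) / delta s m n := by
  have hD0 : (0 : ℝ) < delta s m n := by exact_mod_cast hΔ
  have hbdd : BddAbove {j : ℕ | fn s m n ((j : ℝ) / delta s m n) ≤ x} := bddAbove_of_cast_le hW
  have hmem := Nat.sSup_mem (s := {j : ℕ | fn s m n ((j : ℝ) / delta s m n) ≤ x})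
    ⟨0, by simpa [fn_zero] using hx⟩ hbdd
  refine ⟨_, hW _ hmem, IsGreatest.csSup_eq ⟨⟨_, rfl, hmem⟩, ?_⟩⟩
  rintro u ⟨j, rfl, hj⟩
  have : (j : ℝ) ≤ (sSup {j : ℕ | fn s m n ((j : ℝ) / delta s m n) ≤ x} : ℕ) := by
    exact_mod_cast le_csSup hbdd hj
  gcongr

theorem exists_lowerEnd_eq (hΔ : 1 ≤ delta s m n) {x W : ℝ} (hx : 0 ≤ x)
    (hW : ∀ j : ℕ, j ≤ kStar s m → fn s m n (-(j : ℝ) / delta s m n) ≤ x → (j : ℝ) ≤ W) :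
    ∃ j : ℕ, j ≤ kStar s m ∧ (j : ℝ) ≤ W ∧ lowerEnd s m n x = -(j : ℝ) / delta s m n := by
  have hD0 : (0 : ℝ) < delta s m n := by exact_mod_cast hΔ
  have hbdd : BddAbove {j : ℕ | j ≤ kStar s m ∧ fn s m n (-(j : ℝ) / delta s m n) ≤ x} :=
    ⟨kStar s m, fun j hj => hj.1⟩
  have hmem := Nat.sSup_mem
    (s := {j : ℕ | j ≤ kStar s m ∧ fn s m n (-(j : ℝ) / delta s m n) ≤ x})
    ⟨0, by simpa [fn_zero] using hx⟩ hbdd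
  have hle : ∀ i ∈ {j : ℕ | j ≤ kStar s m ∧ fn s m n (-(j : ℝ) / delta s m n) ≤ x},
      i ≤ sSup {j : ℕ | j ≤ kStar s m ∧ fn s m n (-(j : ℝ) / delta s m n) ≤ x} :=
    fun i hi => le_csSup hbdd hi
  generalize sSup {j : ℕ | j ≤ kStar s m ∧ fn s m n (-(j : ℝ) / delta s m n) ≤ x} = J at hmem hle
  have hJ : J ≤ kStar s m := hmem.1
  refine ⟨J, hJ, hW J hJ hmem.2, IsLeast.csInf_eq ⟨⟨-(J : ℤ), by omega, by omega, ?_, hmem.2⟩, ?_⟩⟩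
  · push_cast; rfl
  rintro u ⟨j, hj1, hj2, rfl, hj⟩
  obtain ⟨i, rfl⟩ : ∃ i : ℕ, j = -(i : ℤ) := ⟨j.natAbs, by omega⟩
  have h1 : (i : ℝ) ≤ J := by exact_mod_cast hle i ⟨by omega, by simpa using hj⟩
  push_cast
  gcongr

end Window

end Density

/-! ### Uniform control of the excess risk -/

section Density

variable {s : ℝ → ℝ}

/-- The difference between the excess risk and its deterministic part, before rescaling: its
increments are the fluctuations `(P_n^T ψ_k - θ_k)² - 1 / |T|`. -/
noncomputable def riskFluct {n : ℕ} (s : ℝ → ℝ) (x : Fin n → ℝ) (T : Finset (Fin n)) (k : ℕ) : ℝ :=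
  risk s x T k - tailSum s k - (k : ℝ) / T.card

theorem riskFluct_sub_of_le {n : ℕ} (hs : IsL2Density s) (x : Fin n → ℝ) (T : Finset (Fin n))
    {a b : ℕ} (h : a ≤ b) :
    riskFluct s x T b - riskFluct s x T a
      = ∑ k ∈ Finset.Ioc a b, ((empMean x T (psi k) - theta s k) ^ 2 - 1 / (T.card : ℝ)) := by
  induction b, h using Nat.le_induction with
  | base => simp
  | succ b hab ih =>
    rw [Finset.sum_Ioc_succ_top (by omega), ← ih]
    unfold riskFluct
    have h1 := risk_succ hs x T b
    have h2 := tailSum_succ hs b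
    push_cast
    linear_combination h1 + h2

theorem excessRisk_sub_fn {n : ℕ} (s : ℝ → ℝ) (x : Fin n → ℝ) (T : Finset (Fin n)) (α : ℝ) :
    excessRisk s x T α - fn s T.card n α = 1 / smallE s T.card n *
      linInterp (fun k => riskFluct s x T k - riskFluct s x T (kStar s T.card))
        ((kStar s T.card : ℝ) + α * delta s T.card n) := by
  unfold excessRisk fn linInterp riskFluct
  set z := (kStar s T.card : ℝ) + α * delta s T.card n with hz
  have hα : α * delta s T.card n = z - kStar s T.card := by rw [hz]; ring
  rw [hα]
  push_cast
  ring

/-- The bound on the fluctuations over a window of `K` models, at the confidence level `1 - O(e^{-u})`: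
`m` is the sample size and `A` bounds `∑_{j ≥ 1} |θ_j|`. The last term is the bias. -/
noncomputable def fluctBound (A u m K : ℝ) : ℝ :=
  (5 * (10 + 4 * A) * u ^ 2 * (m * √K + √m * K) + 3 * A * m) / m ^ 2

theorem fluctBound_mono {A u m K K' : ℝ} (hA : 0 ≤ A) (hm : 0 ≤ m) (h : K ≤ K') :
    fluctBound A u m K ≤ fluctBound A u m K' := by
  unfold fluctBound
  gcongr

theorem measure_fluct_gt_le {n : ℕ} (hs : IsL2Density s) {A : ℝ} (hA0 : 0 ≤ A)
    (hA : ∀ F : Finset ℕ, 0 ∉ F → ∑ j ∈ F, |theta s j| ≤ A) {I : Finset ℕ} (hI : 0 ∉ I)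
    (hIne : I.Nonempty) {T : Finset (Fin n)} (hT : T.Nonempty) {u : ℝ} (hu : 1 ≤ u) :
    (Measure.pi fun _ : Fin n => law s).real {x | fluctBound A u T.card I.card <
        |∑ k ∈ I, ((empMean x T (psi k) - theta s k) ^ 2 - 1 / (T.card : ℝ))|}
      ≤ (2 * T.card * I.card + 4) * Real.exp (-u) := by
  have := isProbabilityMeasure_law hs
  have hm0 : (0 : ℝ) < T.card := by exact_mod_cast hT.card_pos
  have pos : ∀ k ∈ I, 1 ≤ k := fun k hk => Nat.one_le_iff_ne_zero.2 fun h0 => hI (h0 ▸ hk)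
  refine le_trans (measureReal_mono ?_ (measure_ne_top _ _))
    (measure_quadratic_deviation_le (μ := law s) (w := centredPsi s) (b := 3) (C := 1 + 4 * A)
      (measurable_centredPsi s) hIne (by norm_num) (fun k _ => abs_centredPsi_le hs k)
      (fun k _ => integral_centredPsi hs k) (by linarith)
      (integral_sq_sum_centredPsi_le hs hA hI) hT hu)
  intro x hx
  rw [Set.mem_ofPred_eq] at hx ⊢
  set v := ∑ k ∈ I, ∫ t, centredPsi s k t ^ 2 ∂law s with hv
  have hvK : |v - I.card| ≤ 3 * A := by
    have h1 : v - I.card = ∑ k ∈ I, (theta s (2 * k) / √2 - theta s k ^ 2) := by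
      rw [hv, Finset.sum_congr rfl fun k hk => integral_centredPsi_sq hs (pos k hk)]
      simp only [Finset.sum_sub_distrib, Finset.sum_add_distrib, Finset.sum_const, nsmul_eq_mul]
      ring
    have h2 : ∑ k ∈ I, |theta s (2 * k)| ≤ A := by
      rw [← Finset.sum_image (f := fun i => |theta s i|) (g := fun k => 2 * k)
        (fun a _ b _ h => by simpa using h)]
      refine hA _ fun h => ?_
      obtain ⟨k, hk, hk0⟩ := Finset.mem_image.1 h
      have := pos k hk
      omega
    have h3 := hA I hI
    have h4 : √2 ≤ 2 := by rw [Real.sqrt_le_left (by norm_num)]; norm_num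
    rw [h1]
    calc |∑ k ∈ I, (theta s (2 * k) / √2 - theta s k ^ 2)|
        ≤ ∑ k ∈ I, |theta s (2 * k) / √2 - theta s k ^ 2| := Finset.abs_sum_le_sum_abs _ _
      _ ≤ ∑ k ∈ I, (|theta s (2 * k)| + 2 * |theta s k|) := by
          refine Finset.sum_le_sum fun k _ => (abs_sub _ _).trans (add_le_add ?_ ?_)
          · rw [abs_div, abs_of_nonneg (Real.sqrt_nonneg 2)]
            exact div_le_self (abs_nonneg _) (Real.one_le_sqrt.2 one_le_two)
          · rw [abs_pow, sq]
            exact mul_le_mul_of_nonneg_right ((abs_theta_le hs k).trans h4) (abs_nonneg _)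
      _ ≤ 3 * A := by rw [Finset.sum_add_distrib, ← Finset.mul_sum]; linarith
  have hdec : ∑ k ∈ I, ((empMean x T (psi k) - theta s k) ^ 2 - 1 / (T.card : ℝ))
      = ((∑ k ∈ I, (∑ i ∈ T, centredPsi s k (x i)) ^ 2 - T.card * v)
        + T.card * (v - I.card)) / (T.card : ℝ) ^ 2 := by
    have h1 : ∀ k, empMean x T (psi k) - theta s k
        = (∑ i ∈ T, centredPsi s k (x i)) / T.card := by
      intro k
      unfold empMean centredPsi
      rw [Finset.sum_sub_distrib, Finset.sum_const, nsmul_eq_mul]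
      field_simp
    simp only [h1, div_pow, Finset.sum_sub_distrib, Finset.sum_const, nsmul_eq_mul,
      ← Finset.sum_div]
    field_simp
    ring
  rw [hdec, abs_div, abs_of_pos (pow_pos hm0 2), fluctBound, div_lt_div_iff_of_pos_right
    (pow_pos hm0 2)] at hx
  have h5 := abs_add_le (∑ k ∈ I, (∑ i ∈ T, centredPsi s k (x i)) ^ 2 - T.card * v)
    (T.card * (v - I.card))
  rw [abs_mul, abs_of_pos hm0] at h5
  have h6 := mul_le_mul_of_nonneg_left hvK hm0.le
  have h7 : (3 : ℝ) ^ 2 + (1 + 4 * A) = 10 + 4 * A := by ring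
  rw [h7]
  linarith

/-- Union bound over the windows between `k₀` and the models at distance at most `J`. -/
theorem measure_exists_riskFluct_gt_le {n : ℕ} (hs : IsL2Density s) {A : ℝ} (hA0 : 0 ≤ A)
    (hA : ∀ F : Finset ℕ, 0 ∉ F → ∑ j ∈ F, |theta s j| ≤ A) {T : Finset (Fin n)}
    (hT : T.Nonempty) {u : ℝ} (hu : 1 ≤ u) (k₀ J : ℕ) :
    (Measure.pi fun _ : Fin n => law s).real {x | ∃ k, k ≤ k₀ + J ∧ k₀ ≤ k + J ∧
        fluctBound A u T.card J < |riskFluct s x T k - riskFluct s x T k₀|}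
      ≤ 12 * T.card * (J : ℝ) ^ 2 * Real.exp (-u) := by
  classical
  have := isProbabilityMeasure_law hs
  have hm1 : (1 : ℝ) ≤ T.card := by exact_mod_cast hT.card_pos
  set 𝓦 : Finset (Finset ℕ) := (Finset.Ioc k₀ (k₀ + J)).image (fun k => Finset.Ioc k₀ k) ∪
    (Finset.Ico (k₀ - J) k₀).image (fun k => Finset.Ioc k k₀) with h𝓦
  have hW : ∀ I ∈ 𝓦, 0 ∉ I ∧ I.Nonempty ∧ I.card ≤ J := by
    intro I hI
    rcases Finset.mem_union.1 hI with h | h <;> obtain ⟨k, hk, rfl⟩ := Finset.mem_image.1 h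
    · rw [Finset.mem_Ioc] at hk
      refine ⟨by simp, Finset.nonempty_Ioc.2 hk.1, ?_⟩
      rw [Nat.card_Ioc]; omega
    · rw [Finset.mem_Ico] at hk
      refine ⟨by simp, Finset.nonempty_Ioc.2 hk.2, ?_⟩
      rw [Nat.card_Ioc]; omega
  have hcard : (𝓦.card : ℝ) ≤ 2 * J := by
    have h1 := Finset.card_union_le ((Finset.Ioc k₀ (k₀ + J)).image (fun k => Finset.Ioc k₀ k))
      ((Finset.Ico (k₀ - J) k₀).image (fun k => Finset.Ioc k k₀))
    have h2 := Finset.card_image_le (s := Finset.Ioc k₀ (k₀ + J)) (f := fun k => Finset.Ioc k₀ k)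
    have h3 := Finset.card_image_le (s := Finset.Ico (k₀ - J) k₀) (f := fun k => Finset.Ioc k k₀)
    rw [Nat.card_Ioc] at h2
    rw [Nat.card_Ico] at h3
    have : 𝓦.card ≤ 2 * J := by rw [h𝓦]; omega
    exact_mod_cast this
  have hsub : {x : Fin n → ℝ | ∃ k, k ≤ k₀ + J ∧ k₀ ≤ k + J ∧
      fluctBound A u T.card J < |riskFluct s x T k - riskFluct s x T k₀|}
      ⊆ ⋃ I ∈ 𝓦, {x | fluctBound A u T.card I.card <
        |∑ k ∈ I, ((empMean x T (psi k) - theta s k) ^ 2 - 1 / (T.card : ℝ))|} := by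
    rintro x ⟨k, hk1, hk2, hx⟩
    have hmono : ∀ I ∈ 𝓦, fluctBound A u T.card I.card ≤ fluctBound A u T.card J := fun I hI =>
      fluctBound_mono hA0 (by linarith) (by exact_mod_cast (hW I hI).2.2)
    rcases lt_trichotomy k k₀ with h | h | h
    · have hI : Finset.Ioc k k₀ ∈ 𝓦 := Finset.mem_union_right _
        (Finset.mem_image_of_mem (fun k => Finset.Ioc k k₀) (Finset.mem_Ico.2 ⟨by omega, h⟩))
      refine Set.mem_biUnion hI ((hmono _ hI).trans_lt ?_)
      rwa [← riskFluct_sub_of_le hs x T h.le, abs_sub_comm]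
    · rw [h, sub_self, abs_zero] at hx
      have : 0 ≤ fluctBound A u T.card J := by unfold fluctBound; positivity
      linarith
    · have hI : Finset.Ioc k₀ k ∈ 𝓦 := Finset.mem_union_left _
        (Finset.mem_image_of_mem (fun k => Finset.Ioc k₀ k) (Finset.mem_Ioc.2 ⟨h, hk1⟩))
      refine Set.mem_biUnion hI ((hmono _ hI).trans_lt ?_)
      rwa [← riskFluct_sub_of_le hs x T h.le]
  refine (measureReal_mono hsub (measure_ne_top _ _)).trans
    ((measureReal_biUnion_finset_le 𝓦 _).trans ?_)
  calc ∑ I ∈ 𝓦, (Measure.pi fun _ : Fin n => law s).real {x | fluctBound A u T.card I.card <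
        |∑ k ∈ I, ((empMean x T (psi k) - theta s k) ^ 2 - 1 / (T.card : ℝ))|}
      ≤ ∑ _I ∈ 𝓦, 6 * T.card * J * Real.exp (-u) := by
        refine Finset.sum_le_sum fun I hI => ?_
        obtain ⟨h1, h2, h3⟩ := hW I hI
        refine (measure_fluct_gt_le hs hA0 hA h1 h2 hT hu).trans ?_
        refine mul_le_mul_of_nonneg_right ?_ (Real.exp_nonneg _)
        have h4 : (I.card : ℝ) ≤ J := by exact_mod_cast h3
        have h5 : (1 : ℝ) ≤ I.card := by exact_mod_cast h2.card_pos
        have h6 : (T.card : ℝ) * I.card ≤ T.card * J := by gcongr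
        have h7 : 1 * 1 ≤ (T.card : ℝ) * J :=
          mul_le_mul hm1 (h5.trans h4) zero_le_one (by linarith)
        linarith
    _ = 𝓦.card * (6 * T.card * J * Real.exp (-u)) := by rw [Finset.sum_const, nsmul_eq_mul]
    _ ≤ 2 * J * (6 * T.card * J * Real.exp (-u)) := by gcongr
    _ = _ := by ring

/-- The deviation bound over windows of length `O((1 + x) Δ)`, on the scale `𝔢`. -/
theorem one_div_smallE_mul_fluctBound_le {m n J : ℕ} (hm : 1 ≤ m) (hN : 0 < (n : ℝ) - m)
    (hΔ : 1 ≤ delta s m n) {A u c D x : ℝ} (hA : 0 ≤ A) (hu : 1 ≤ u) (hc : 1 ≤ c) (hD : 1 ≤ D)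
    (hx : 0 ≤ x) (hJ : (J : ℝ) ≤ c * (1 + x) * delta s m n) (hΔm : (delta s m n : ℝ) ≤ D * m) :
    1 / smallE s m n * fluctBound A u m J
      ≤ (5 * (10 + 4 * A) * c * (1 + D) + 3 * A) * (1 + x) * u ^ 2 * √(((n : ℝ) - m) / m) := by
  have hm0 : (0 : ℝ) < m := by exact_mod_cast hm
  have hd1 : 1 ≤ √(delta s m n : ℝ) := Real.one_le_sqrt.2 (by exact_mod_cast hΔ)
  have hσ : 0 < √(m : ℝ) := Real.sqrt_pos.2 hm0
  have hν : 0 < √((n : ℝ) - m) := Real.sqrt_pos.2 hN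
  have hms : √(m : ℝ) ^ 2 = m := Real.sq_sqrt hm0.le
  have hds : √(delta s m n : ℝ) ^ 2 = delta s m n := Real.sq_sqrt (Nat.cast_nonneg _)
  have hjs : √(J : ℝ) ^ 2 = J := Real.sq_sqrt (Nat.cast_nonneg _)
  have hj0 : 0 ≤ √(J : ℝ) := Real.sqrt_nonneg _
  rw [smallE_eq hN, Real.sqrt_div' _ hm0.le, fluctBound]
  generalize √((n : ℝ) - m) = ν at *
  rw [← hjs, ← hds] at hJ
  rw [← hms, ← hds] at hΔm
  nth_rewrite 2 [← hjs]
  rw [← hms, Real.sqrt_sq hσ.le]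
  generalize √(m : ℝ) = σ at *
  generalize √(delta s m n : ℝ) = d at *
  generalize √(J : ℝ) = j at *
  have hd0 : 0 < d := by linarith
  have hcx : 1 ≤ c * (1 + x) := one_le_mul_of_one_le_of_one_le hc (by linarith)
  have h1 : j / d ≤ c * (1 + x) := by
    rw [div_le_iff₀ hd0]
    refine le_of_sq_le_sq (hJ.trans ?_) (by positivity)
    rw [mul_pow]
    exact mul_le_mul_of_nonneg_right (le_self_pow₀ hcx two_ne_zero) (by positivity)
  have h2 : d ≤ D * σ := by
    refine le_of_sq_le_sq (hΔm.trans ?_) (by positivity)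
    rw [mul_pow]
    exact mul_le_mul_of_nonneg_right (le_self_pow₀ hD two_ne_zero) (by positivity)
  have h3 : j ^ 2 / (σ * d) ≤ c * (1 + x) * D := by
    rw [div_le_iff₀ (by positivity)]
    have := mul_le_mul_of_nonneg_left h2 (by positivity : 0 ≤ c * (1 + x) * d)
    linarith
  have h4 : 3 * A / d ≤ 3 * A * ((1 + x) * u ^ 2) := by
    refine (div_le_self (by positivity) hd1).trans (le_mul_of_one_le_right (by positivity) ?_)
    exact one_le_mul_of_one_le_of_one_le (by linarith) (one_le_pow₀ hu)
  calc 1 / (d / (σ * ν)) * ((5 * (10 + 4 * A) * u ^ 2 * (σ ^ 2 * j + σ * j ^ 2) + 3 * A * σ ^ 2)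
        / (σ ^ 2) ^ 2)
      = (5 * (10 + 4 * A) * u ^ 2 * (j / d + j ^ 2 / (σ * d)) + 3 * A / d) * (ν / σ) := by
        field_simp
    _ ≤ (5 * (10 + 4 * A) * u ^ 2 * (c * (1 + x) + c * (1 + x) * D)
          + 3 * A * ((1 + x) * u ^ 2)) * (ν / σ) := by gcongr
    _ = _ := by ring

/-- The training sample carries a fixed proportion of the data. -/
theorem sqrt_sub_div_le {n m : ℕ} {δ₄ : ℝ} (hδ₄ : 0 < δ₄) (hn : 2 ≤ n) (hm : 1 ≤ m)
    (hup : (n : ℝ) - m ≤ (n : ℝ) ^ (1 - δ₄)) :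
    √(((n : ℝ) - m) / m)
      ≤ 1 / √(1 - (2 : ℝ) ^ (-δ₄)) * (n : ℝ) ^ (-min (1 / 12) (δ₄ / 2)) := by
  have hn2 : (2 : ℝ) ≤ n := by exact_mod_cast hn
  have hn0 : (0 : ℝ) < n := by linarith
  have hm0 : (0 : ℝ) < m := by exact_mod_cast hm
  have hq : 0 < 1 - (2 : ℝ) ^ (-δ₄) :=
    sub_pos.2 (Real.rpow_lt_one_of_one_lt_of_neg one_lt_two (by linarith))
  have h1 : (n : ℝ) ^ (-δ₄) ≤ (2 : ℝ) ^ (-δ₄) :=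
    Real.rpow_le_rpow_of_nonpos zero_lt_two hn2 (by linarith)
  have h2 : (n : ℝ) ^ (1 - δ₄) = n * (n : ℝ) ^ (-δ₄) := by
    rw [sub_eq_add_neg, Real.rpow_add hn0, Real.rpow_one]
  have h3 : n * (1 - (2 : ℝ) ^ (-δ₄)) ≤ m := by
    have := mul_le_mul_of_nonneg_left h1 hn0.le
    linarith
  have h4 : ((n : ℝ) - m) / m ≤ (n : ℝ) ^ (-δ₄) / (1 - (2 : ℝ) ^ (-δ₄)) := by
    rw [div_le_div_iff₀ hm0 hq]
    have h5 := mul_le_mul_of_nonneg_right (hup.trans h2.le) hq.le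
    have h6 := mul_le_mul_of_nonneg_left h3 (Real.rpow_nonneg hn0.le (-δ₄))
    linarith
  refine (Real.sqrt_le_sqrt h4).trans ?_
  rw [Real.sqrt_div' _ hq.le, one_div, inv_mul_eq_div]
  gcongr
  rw [Real.sqrt_eq_rpow, ← Real.rpow_mul hn0.le]
  refine Real.rpow_le_rpow_of_exponent_le (by linarith) ?_
  have := min_le_right (1 / 12) (δ₄ / 2)
  linarith

/-- On the event that `riskFluct` is controlled over the window, so is the rescaled excess risk. -/
theorem abs_excessRisk_sub_fn_le {n : ℕ} {T : Finset (Fin n)} {x : Fin n → ℝ} {z M : ℝ} {a b : ℕ}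
    (hΔ : 1 ≤ delta s T.card n)
    (ha : a ≤ kStar s T.card) (hl : lowerEnd s T.card n z = -(a : ℝ) / delta s T.card n)
    (hb : upperEnd s T.card n z = (b : ℝ) / delta s T.card n)
    (h : ∀ k, k ≤ kStar s T.card + b → kStar s T.card ≤ k + a →
      |riskFluct s x T k - riskFluct s x T (kStar s T.card)| ≤ M) {α : ℝ}
    (hα : α ∈ Set.Icc (lowerEnd s T.card n z) (upperEnd s T.card n z)) :
    |excessRisk s x T α - fn s T.card n α| ≤ 1 / smallE s T.card n * M := by
  have hD0 : (0 : ℝ) < delta s T.card n := by exact_mod_cast hΔ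
  have he : 0 ≤ 1 / smallE s T.card n := one_div_nonneg.2 (Real.sqrt_nonneg _)
  rw [hl, hb] at hα
  have h1 := (div_le_iff₀ hD0).1 hα.1
  have h2 := (le_div_iff₀ hD0).1 hα.2
  rw [excessRisk_sub_fn, abs_mul, abs_of_nonneg he]
  refine mul_le_mul_of_nonneg_left (abs_linInterp_le (a := kStar s T.card - a)
    (b := kStar s T.card + b) (fun k hk1 hk2 => h k hk2 (by omega)) ?_ ?_) he
  · rw [Nat.cast_sub ha]; linarith
  · push_cast; linarith

end Density

end CosDensity

open CosDensity
theorem claim3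
    (c₁ δ₁ δ₄ δ₅ : ℝ) (hc₁ : 0 ≤ c₁) (hδ₁ : 0 ≤ δ₁) (hδ₄ : 0 < δ₄) (hδ₅ : 0 < δ₅) :
    ∃ κ₁ : ℝ, 0 ≤ κ₁ ∧
      ∀ (s : ℝ → ℝ), IsL2Density s →
        Antitone (fun j : ℕ => theta s j ^ 2) →
        (∀ k : ℕ, 1 ≤ k → tailSum s k ≤ c₁ / (k : ℝ) ^ (2 + δ₁)) →
      ∀ (n nt : ℕ), 1 ≤ nt →
        (n : ℝ) - nt ≤ (n : ℝ) ^ (1 - δ₄) →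
        (n : ℝ) ^ (2 / 3 + δ₅) ≤ (n : ℝ) - nt →
        ConvexOn ℝ (Set.Ici (-(kStar s nt : ℝ) / delta s nt n)) (fn s nt n) ∧
        ∀ (Ω : Type*) [MeasurableSpace Ω] (P : Measure Ω) [IsProbabilityMeasure P]
          (X : Fin n → Ω → ℝ),
          iIndepFun X P → (∀ i, HasLaw (X i) (law s) P) →
        ∀ T : Finset (Fin n), T.card = nt →
        ∀ x y : ℝ, 0 < x → 0 < y →
          1 - Real.exp (-y) ≤ P.real {ω |
            ∀ α ∈ Set.Icc (lowerEnd s nt n x) (upperEnd s nt n x),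
              |excessRisk s (fun i => X i ω) T α - fn s nt n α| ≤
                κ₁ * (1 + x) * (Real.log (2 + x) + y + Real.log n) ^ 2 *
                  (n : ℝ) ^ (-min (1 / 12) (δ₄ / 2))} := by
  set C : ℝ := 27 * c₁ + 1 with hCdef
  have hC : 0 ≤ C := by positivity
  obtain ⟨A, hA0, hA⟩ := exists_sum_abs_theta_le C
  -- windows have length at most `c (1 + x) Δ`, and `Δ ≤ D n_t`
  obtain ⟨c, hc⟩ : ∃ c, c = 2 + 2 * C := ⟨_, rfl⟩
  obtain ⟨D, hD⟩ : ∃ D, D = 4 + 2 * C := ⟨_, rfl⟩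
  obtain ⟨M, hM⟩ : ∃ M, M = 12 * (c * D) ^ 2 := ⟨_, rfl⟩
  have hc1 : 1 ≤ c := by linarith
  have hD1 : 1 ≤ D := by linarith
  have hM12 : 12 ≤ M := by
    have : 1 ≤ (c * D) ^ 2 := one_le_pow₀ (one_le_mul_of_one_le_of_one_le hc1 hD1)
    linarith
  have hlogM : 1 ≤ Real.log M := by
    rw [Real.le_log_iff_exp_le (by linarith)]
    linarith [Real.exp_one_lt_d9]
  set κ₀ := 5 * (10 + 4 * A) * c * (1 + D) + 3 * A with hκ₀
  have hκ₀0 : 0 ≤ κ₀ := by positivity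
  refine ⟨κ₀ * (3 + 2 * Real.log M) ^ 2 * (1 / √(1 - (2 : ℝ) ^ (-δ₄))), by positivity, ?_⟩
  intro s hs hanti htail n nt hnt hup hlow
  refine ⟨convexOn_fn hs hanti nt n, ?_⟩
  intro Ω _ P _ X hindep hlaw T hT x y hx hy
  subst hT
  have hdec : ∀ k : ℕ, 1 ≤ k → theta s k ^ 2 ≤ C / (k : ℝ) ^ 3 := fun k hk =>
    theta_sq_le hs hanti hc₁ hδ₁ htail hk
  have hAs := hA s hdec
  have hm1 : (1 : ℝ) ≤ T.card := by exact_mod_cast hnt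
  have hTn : T.card ≤ n := by simpa using Finset.card_le_univ T
  have hn1 : (1 : ℝ) ≤ n := hm1.trans (by exact_mod_cast hTn)
  have hN : 1 ≤ (n : ℝ) - T.card := (Real.one_le_rpow hn1 (by linarith)).trans hlow
  have hn2' : (2 : ℝ) ≤ n := by linarith
  have hn2 : 2 ≤ n := by exact_mod_cast hn2'
  have hTne : T.Nonempty := Finset.card_pos.1 hnt
  have hlog2 : 1 / 2 ≤ Real.log 2 := by linarith [Real.log_two_gt_d9]
  have hlogx : Real.log 2 ≤ Real.log (2 + x) := Real.log_le_log zero_lt_two (by linarith)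
  have hlogn : Real.log 2 ≤ Real.log n := Real.log_le_log zero_lt_two hn2'
  set L := Real.log (2 + x) + y + Real.log n with hL
  have hLpos : 1 / 2 ≤ L := by linarith
  have hrate := sqrt_sub_div_le hδ₄ hn2 hnt hup
  set rate := (n : ℝ) ^ (-min (1 / 12) (δ₄ / 2))
  have hrate0 : 0 ≤ rate := Real.rpow_nonneg (by linarith) _
  have hrhs : 0 ≤ κ₀ * (3 + 2 * Real.log M) ^ 2 * (1 / √(1 - (2 : ℝ) ^ (-δ₄))) * (1 + x) * L ^ 2
      * rate := by positivity
  rcases Nat.eq_zero_or_pos (delta s T.card n) with hΔ | hΔ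
  · have he : smallE s T.card n = 0 := by simp [smallE, bigE, hΔ]
    have : {ω | ∀ α ∈ Set.Icc (lowerEnd s T.card n x) (upperEnd s T.card n x),
        |excessRisk s (fun i => X i ω) T α - fn s T.card n α| ≤
          κ₀ * (3 + 2 * Real.log M) ^ 2 * (1 / √(1 - (2 : ℝ) ^ (-δ₄))) * (1 + x) * L ^ 2
            * rate} = Set.univ := by
      refine Set.eq_univ_of_forall fun ω α _ => ?_
      simpa [excessRisk, fn, he] using hrhs
    rw [this, probReal_univ]
    linarith [Real.exp_nonneg (-y)]
  -- `W` bounds the number of models on either side of `k_*` that enter `[a_x, b_x]`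
  have hΔm := delta_le (n := n) hs hC hdec hnt hN
  rw [← hD] at hΔm
  have hD0 : (0 : ℝ) ≤ delta s T.card n := Nat.cast_nonneg _
  have hxΔ : 0 ≤ x * delta s T.card n := by positivity
  have hCΔ : 0 ≤ C * delta s T.card n := by positivity
  have hCxΔ : 0 ≤ C * x * delta s T.card n := by positivity
  set W := c * (1 + x) * delta s T.card n with hWdef
  have hWexp : W = (1 + 2 * C + 2 * x) * delta s T.card n + delta s T.card n
      + 2 * (C * x * delta s T.card n) := by rw [hWdef, hc]; ring
  obtain ⟨b, hbW, hb⟩ := exists_upperEnd_eq (s := s) (m := T.card) (n := n) hΔ hx.le (W := W)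
    fun j hj => (le_of_fn_le_right hs hanti hC hdec hnt hN hΔ hx.le hj).trans (by linarith)
  obtain ⟨a, hak, haW, ha⟩ := exists_lowerEnd_eq (s := s) (m := T.card) (n := n) hΔ hx.le (W := W)
    fun j hjk hj =>
      (le_of_fn_le_left hs hanti hC hdec hnt hN hΔ hx.le hjk hj).trans (by linarith)
  set J := ⌊W⌋₊ with hJdef
  have hW0 : 0 ≤ W := by positivity
  have hJW : (J : ℝ) ≤ W := Nat.floor_le hW0
  have haJ : a ≤ J := Nat.le_floor haW
  have hbJ : b ≤ J := Nat.le_floor hbW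
  -- the level at which the union bound over `O(J)` windows costs at most `exp (-y)`
  set u := y + Real.log (M * (2 + x) ^ 2 * n ^ 3) with hu
  have hlogsplit : Real.log (M * (2 + x) ^ 2 * n ^ 3)
      = Real.log M + 2 * Real.log (2 + x) + 3 * Real.log n := by
    rw [Real.log_mul (by positivity) (by positivity), Real.log_mul (by positivity) (by positivity),
      Real.log_pow, Real.log_pow]
    push_cast; ring
  have hu1 : 1 ≤ u := by rw [hu, hlogsplit]; linarith
  have huL : u ≤ (3 + 2 * Real.log M) * L := by
    have h1 : Real.log M * 1 ≤ Real.log M * (2 * L) :=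
      mul_le_mul_of_nonneg_left (by linarith) (by linarith)
    have h2 : (3 + 2 * Real.log M) * L = 3 * L + Real.log M * (2 * L) := by ring
    rw [hu, hlogsplit, h2]
    linarith
  have hfail := measure_exists_riskFluct_gt_le hs hA0 hAs hTne hu1 (kStar s T.card) J
  set Bad : Set (Fin n → ℝ) := {x | ∃ k, k ≤ kStar s T.card + J ∧ kStar s T.card ≤ k + J ∧
    fluctBound A u T.card J < |riskFluct s x T k - riskFluct s x T (kStar s T.card)|} with hBad
  have hbad : (Measure.pi fun _ : Fin n => law s).real Bad ≤ Real.exp (-y) := by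
    refine hfail.trans ?_
    have h1 : (J : ℝ) ≤ c * D * ((2 + x) * n) := by
      calc (J : ℝ) ≤ c * (1 + x) * delta s T.card n := hJW
        _ ≤ c * (2 + x) * (D * n) := by
            have h1 : (T.card : ℝ) ≤ n := by linarith
            have h2 : (delta s T.card n : ℝ) ≤ D * n :=
              hΔm.trans (mul_le_mul_of_nonneg_left h1 (by linarith))
            gcongr
            linarith
        _ = _ := by ring
    have h2 : 12 * T.card * (J : ℝ) ^ 2 ≤ M * (2 + x) ^ 2 * n ^ 3 := by
      calc 12 * T.card * (J : ℝ) ^ 2 ≤ 12 * n * (c * D * ((2 + x) * n)) ^ 2 := by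
            gcongr
        _ = _ := by rw [hM]; ring
    calc 12 * T.card * (J : ℝ) ^ 2 * Real.exp (-u)
        ≤ M * (2 + x) ^ 2 * n ^ 3 * Real.exp (-u) := by gcongr
      _ = Real.exp (-y) := by
          rw [hu, neg_add, Real.exp_add, Real.exp_neg (Real.log _), Real.exp_log (by positivity)]
          field_simp
  -- the event depends on the joint law only; `le_map_apply` spares its measurability
  have haem : ∀ i, AEMeasurable (X i) P := fun i => (hlaw i).aemeasurable
  have hmap : P.map (fun ω i => X i ω) = Measure.pi fun _ : Fin n => law s := by
    rw [(iIndepFun_iff_map_fun_eq_pi_map haem).1 hindep]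
    congr 1
    exact funext fun i => (hlaw i).map_eq
  have hPbad : P.real ((fun ω i => X i ω) ⁻¹' Bad) ≤ Real.exp (-y) := by
    refine le_trans ?_ hbad
    rw [← hmap]
    have : IsProbabilityMeasure (P.map (fun ω i => X i ω)) :=
      Measure.isProbabilityMeasure_map (aemeasurable_pi_lambda _ haem)
    exact ENNReal.toReal_mono (measure_ne_top _ _)
      (Measure.le_map_apply (aemeasurable_pi_lambda _ haem) _)
  have hcover : (Set.univ : Set Ω) ⊆ {ω |
      ∀ α ∈ Set.Icc (lowerEnd s T.card n x) (upperEnd s T.card n x),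
        |excessRisk s (fun i => X i ω) T α - fn s T.card n α| ≤
          κ₀ * (3 + 2 * Real.log M) ^ 2 * (1 / √(1 - (2 : ℝ) ^ (-δ₄))) * (1 + x) * L ^ 2
            * rate} ∪ (fun ω i => X i ω) ⁻¹' Bad := by
    intro ω _
    by_cases hω : (fun i => X i ω) ∈ Bad
    · exact Or.inr hω
    refine Or.inl fun α hα => ?_
    refine (abs_excessRisk_sub_fn_le hΔ hak ha hb (M := fluctBound A u T.card J) ?_ hα).trans ?_
    · intro k hk1 hk2
      by_contra hcon
      exact hω ⟨k, by omega, by omega, not_le.1 hcon⟩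
    · refine (one_div_smallE_mul_fluctBound_le hnt (by linarith) hΔ hA0 hu1 hc1 hD1 hx.le hJW
        hΔm).trans ?_
      calc κ₀ * (1 + x) * u ^ 2 * √(((n : ℝ) - T.card) / T.card)
          ≤ κ₀ * (1 + x) * ((3 + 2 * Real.log M) * L) ^ 2
            * (1 / √(1 - (2 : ℝ) ^ (-δ₄)) * rate) := by gcongr
        _ = _ := by ring
  have h1 := (measureReal_mono hcover (measure_ne_top P _)).trans
    (measureReal_union_le (μ := P) _ _)
  rw [probReal_univ] at h1
  linarith
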